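/- All graphs are finite and simple. The Mostar index of a connected graph $G$ is $Mo(G)=\sum_{uv\in E(G)}|n_u-n_v|$, where, for an edge $uv$, $n_u$ is the number of vertices of $G$ closer to $u$ than to $v$, and $n_v$ is the number of vertices closer to $v$ than to $u$. A path $u_0u_1\cdots u_r$ with $r\ge 1$ in $G$ is a pendent path of length $r$ (at $u_r$) if $\deg(u_0)=1$, $\deg(u_r)\ge 2$, and $\deg(u_i)=2$ for $1\le i\le r-1$. For positive integers $n,r,a,b$ with $(a+b)r\le n-2$, let $A^r_{n,a,b}$ be the $n$-vertex tree obtained from the path $v_1v_2\cdots v_m$ with $m=n-(a+b)r$ by attaching $a$ pendent paths of length $r$ at $v_1$ and $b$ pendent paths of length $r$ at $v_m$. Let $P_n$ be the path on $n$ vertices. Let $n,k,r$ be integers and let $T$ be a tree of order $n$. Say that $T$ is a minimizer if $T$ has exactly $k$ pendent paths of length $r$ and $Mo(T)$ is minimum among all trees of order $n$ with exactly $k$ pendent paths of length $r$. (i) If $k=1$ and $2\le r\le n-3$, then $T$ is a minimizer if and only if $T\cong A^1_{n,1,2}$. (ii) If $k=2$ and $1\le r\le n-2$, then $T$ is a minimizer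 if and only if $T\cong P_n$. (iii) If $k\ge 3$ and $1\le r\le \frac{n-2}{k}$, then $T$ is a minimizer if and only if $T\cong A^r_{n,\lceil k/2\rceil,\lfloor k/2\rfloor}$. -/

import Mathlib

namespace Mostar

/-- The number `n_u` of vertices of `G` that are closer to `u` than to `v`. -/
noncomputable def numCloser {V : Type*} (G : SimpleGraph V) (u v : V) : ℕ :=
  Set.ncard {w : V | G.dist w u < G.dist w v}

/-- The contribution `ψ(uv) = |n_u - n_v|` of an (unordered) edge `uv`. -/
noncomputable def edgeContribution {V : Type*} (G : SimpleGraph V) : Sym2 V → ℤ :=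
  Sym2.lift ⟨fun u v => |(numCloser G u v : ℤ) - (numCloser G v u : ℤ)|,
    fun _ _ => abs_sub_comm _ _⟩

open Classical in
/-- The Mostar index `Mo(G) = ∑_{uv ∈ E(G)} |n_u - n_v|` of a finite graph. -/
noncomputable def mostarIndex {V : Type*} [Fintype V] (G : SimpleGraph V) : ℤ :=
  ∑ e ∈ G.edgeFinset, edgeContribution G e

open Classical in
/-- `u 0, u 1, …, u r` is a pendent path of length `r ≥ 1` (at `u r`): a path in `G` with
`d(u 0) = 1`, `d(u r) ≥ 2`, and all the other vertices of degree `2`. -/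
def IsPendentPath {V : Type*} [Fintype V] (G : SimpleGraph V) (r : ℕ)
    (u : Fin (r + 1) → V) : Prop :=
  1 ≤ r ∧ Function.Injective u ∧ (∀ i : Fin r, G.Adj (u i.castSucc) (u i.succ)) ∧
    G.degree (u 0) = 1 ∧ 2 ≤ G.degree (u (Fin.last r)) ∧
    ∀ i : Fin (r + 1), i ≠ 0 → i ≠ Fin.last r → G.degree (u i) = 2

/-- The number of pendent paths of length `r` in `G`. The two ends of a pendent path have different
degrees, so each such path is listed by exactly one vertex sequence. -/
noncomputable def numPendentPaths {V : Type*} [Fintype V] (G : SimpleGraph V) (r : ℕ) : ℕ :=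
  Set.ncard {u : Fin (r + 1) → V | IsPendentPath G r u}

/-- `G` is a tree with exactly `k` pendent paths of length `r`. -/
def IsTreeWithPendentPaths {V : Type*} [Fintype V] (G : SimpleGraph V) (k r : ℕ) : Prop :=
  G.IsTree ∧ numPendentPaths G r = k

/-- `T` has minimum Mostar index among all trees of the same order with exactly `k` pendent paths
of length `r` (up to isomorphism, all trees of this order live on the vertex set of `T`). -/
def IsMostarMinimizer {V : Type*} [Fintype V] (T : SimpleGraph V) (k r : ℕ) : Prop :=
  IsTreeWithPendentPaths T k r ∧
    ∀ T' : SimpleGraph V, IsTreeWithPendentPaths T' k r → mostarIndex T ≤ mostarIndex T'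

/-- The vertices of `A^r_{n,a,b}`: the path `v_1, …, v_m` with `m = n - (a + b) r`, and the `r` new
vertices of each of the `a` pendent paths attached at `v_1` and the `b` ones attached at `v_m`. -/
abbrev AVertex (n r a b : ℕ) : Type :=
  Fin (n - (a + b) * r) ⊕ ((Fin a ⊕ Fin b) × Fin r)

/-- The edges of `A^r_{n,a,b}`, each in one orientation (pointing along the path, or away from it
on the attached pendent paths). -/
def aRel (n r a b : ℕ) : AVertex n r a b → AVertex n r a b → Prop
  | .inl i, .inl j => i.val + 1 = j.val
  | .inl i, .inr (.inl _, j) => i.val = 0 ∧ j.val = 0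
  | .inl i, .inr (.inr _, j) => i.val + 1 = n - (a + b) * r ∧ j.val = 0
  | .inr (p, i), .inr (q, j) => p = q ∧ i.val + 1 = j.val
  | .inr _, .inl _ => False

/-- The graph `A^r_{n,a,b}`, a tree of order `n` when `(a + b) r ≤ n - 2`. -/
def aTree (n r a b : ℕ) : SimpleGraph (AVertex n r a b) :=
  SimpleGraph.fromRel (aRel n r a b)

end Mostar

/-! In a tree with `n` vertices the two sides of an edge partition the vertices, so an edge
contributes `n` minus twice its smaller side (`mostarIndex_eq`). Minimizing the Mostar index
therefore means maximizing the sum of the smaller sides.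

Fix `a + b` arms of length `r`, that is, paths starting at leaves and sharing at most their last
vertices (`IsArmFamily`). Their edges contribute the same amount in every tree of order `n`, since
the edge at distance `t` from the leaf cuts off `t + 1` vertices. Only the `m - 1` remaining core
edges matter, where `m = n - (a + b) r`. They are compared with the central path of the extremal
tree level by level: for every `j`, no tree has more core edges with smaller side above `j`
(`card_level_le`). To see this, let `F` be the set of these edges and take, at opposite ends, two
disjoint sides `X` and `Y` of edges of `F` which span no edge of `F`. Both have more than `j`
vertices, and if they hold `p` and `q` arms, they have at least `p r + 1` and `q r + 1`. The edges
inside `X`, those inside `Y`, the edges of the other arms and `F` are disjoint sets among `n - 1`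
edges, which bounds `F`. The bound is weakest when the arms are split as evenly as possible.

Equality of the sums gives equality on every level. Then `X` and `Y` consist of arms and one further
vertex each, all arms end at these two vertices, and the core is the path between them
(`nonempty_iso_of_lt_smallSide`).

For `k ≥ 3` the arms are the pendent paths themselves. For `k ≤ 2` they are leaves, with `r`
replaced by `1`: every tree has two leaves, and a tree with exactly one pendent path of length `r`
has three, because otherwise it would be a path, which has two such pendent paths. -/

namespace Mostar

/-! ### Cuts consisting of a single edge, and the sides of an edge of a tree -/

open Finset SimpleGraph
open scoped Classical

/-- A set of vertices containing `x` and closed under adjacency is everything. -/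
theorem mem_of_adj_closed {V : Type*} {G : SimpleGraph V} (hG : G.Connected) (S : Set V) {x : V}
    (hx : x ∈ S) (h : ∀ y ∈ S, ∀ z, G.Adj y z → z ∈ S) (z : V) : z ∈ S := by
  by_contra hz
  obtain ⟨p⟩ := hG.preconnected x z
  obtain ⟨d, -, h1, h2⟩ := p.exists_boundary_dart S hx hz
  exact h2 (h _ h1 _ d.adj)

variable {V : Type*}

/-- `uv` with `u ∈ S` is the only edge of `G` that leaves `S`. -/
structure IsCut (G : SimpleGraph V) (S : Finset V) (u v : V) : Prop where
  adj : G.Adj u v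
  mem : u ∈ S
  notMem : v ∉ S
  unique : ∀ x ∈ S, ∀ y ∉ S, G.Adj x y → x = u ∧ y = v

namespace IsCut

variable {G : SimpleGraph V} {S : Finset V} {u v : V}

/-- A walk from `S` to `v` can leave `S` only at `u`, so a shortest one visits `u` strictly before
`v`. -/
theorem dist_lt (h : IsCut G S u v) (hG : G.Connected) {w : V} (hw : w ∈ S) :
    G.dist w u < G.dist w v := by
  obtain ⟨p, hp⟩ := hG.exists_walk_length_eq_dist w v
  obtain ⟨d, hd, h1, h2⟩ := p.exists_boundary_dart S hw h.notMem
  obtain ⟨hu, -⟩ := h.unique _ h1 _ h2 d.adj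
  have hmem : u ∈ p.support := hu ▸ p.dart_fst_mem_support_of_mem_darts hd
  calc G.dist w u ≤ (p.takeUntil u hmem).length := dist_le _
    _ < p.length := p.length_takeUntil_lt_length hmem h.adj.ne
    _ = _ := hp

theorem mem_edges (h : IsCut G S u v) {x y : V} (p : G.Walk x y) (hx : x ∈ S) (hy : y ∉ S) :
    s(u, v) ∈ p.edges := by
  obtain ⟨d, hd, h1, h2⟩ := p.exists_boundary_dart S hx hy
  obtain ⟨e1, e2⟩ := h.unique _ h1 _ h2 d.adj
  have := List.mem_map_of_mem (f := Dart.edge) hd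
  rw [Walk.edges]
  convert this
  rw [← e1, ← e2]; rfl

/-- A path whose ends are outside of `S` does not meet `S`. -/
theorem notMem_of_mem_support (h : IsCut G S u v) {x y : V} {p : G.Walk x y} (hp : p.IsPath)
    (hx : x ∉ S) (hy : y ∉ S) {z : V} (hz : z ∈ p.support) : z ∉ S := by
  intro hzS
  have h1 := h.mem_edges (p.dropUntil z hz) hzS hy
  have h2 := h.mem_edges (p.takeUntil z hz).reverse hzS hx
  rw [Walk.edges_reverse, List.mem_reverse] at h2
  have h3 := hp.isTrail.edges_nodup
  rw [← p.take_spec hz, Walk.edges_append] at h3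
  exact (List.nodup_append.1 h3).2.2 _ h2 _ h1 rfl

end IsCut

variable [Fintype V]

/-- The vertices closer to `u` than to `v`. -/
noncomputable def side (G : SimpleGraph V) (u v : V) : Finset V :=
  {w | G.dist w u < G.dist w v}

theorem numCloser_eq_card_side (G : SimpleGraph V) (u v : V) :
    numCloser G u v = #(side G u v) := by
  rw [numCloser, ← Set.ncard_coe_finset]
  congr 1
  ext w
  simp [side]

namespace IsCut

variable {G : SimpleGraph V} {S : Finset V} {u v : V}

theorem compl (h : IsCut G S u v) : IsCut G Sᶜ v u where
  adj := h.adj.symm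
  mem := by simpa using h.notMem
  notMem := by simpa using h.mem
  unique x hx y hy hxy := by
    simp only [mem_compl, not_not] at hx hy
    exact (h.unique y hy x hx hxy.symm).symm

/-- `dist_lt` for `S` and for its complement decides which end each vertex is closer to. Hence
exhibiting any cut through an edge computes the sets counted by the Mostar index. -/
theorem eq_side (h : IsCut G S u v) (hG : G.Connected) : S = side G u v := by
  ext w
  simp only [side, mem_filter, mem_univ, true_and]
  refine ⟨h.dist_lt hG, fun hw => ?_⟩
  by_contra hS
  exact absurd (h.compl.dist_lt hG (mem_compl.2 hS)) (by omega)

/-- `S` is connected, so it spans at least `#S - 1` edges. -/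
theorem card_le_card_edges_inside (h : IsCut G S u v) (hG : G.Connected) :
    #S ≤ #{e ∈ G.edgeFinset | ∀ x ∈ e, x ∈ S} + 1 := by
  -- Charge each vertex of `S` other than `u` to an edge towards a neighbour nearer to `u`. This
  -- edge stays inside `S`, as only `u` has a neighbour outside.
  have hex : ∀ w ∈ S.erase u, ∃ w' ∈ S, G.Adj w w' ∧ G.dist w' u + 1 = G.dist w u := by
    intro w hw
    obtain ⟨hwu, hwS⟩ := mem_erase.1 hw
    obtain ⟨p, hp⟩ := hG.exists_walk_length_eq_dist w u
    cases p with
    | nil => exact absurd rfl hwu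
    | @cons _ w' _ hadj q =>
      have h1 : G.dist w' u ≤ q.length := dist_le q
      have h2 : G.dist w u ≤ G.dist w' u + 1 := by
        obtain ⟨q', hq'⟩ := hG.exists_walk_length_eq_dist w' u
        rw [← hq']; exact dist_le (Walk.cons hadj q')
      rw [Walk.length_cons] at hp
      refine ⟨w', ?_, hadj, by omega⟩
      by_contra hw'
      exact hwu (h.unique _ hwS _ hw' hadj).1
  choose! f hfS hfadj hfdist using hex
  have hle : #(S.erase u) ≤ #{e ∈ G.edgeFinset | ∀ x ∈ e, x ∈ S} := by
    refine card_le_card_of_injOn (fun w => s(w, f w)) ?_ ?_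
    · intro w hw
      have hw' := mem_coe.1 hw
      simp only [coe_filter, Set.mem_ofPred_eq, mem_edgeFinset, mem_edgeSet, Sym2.mem_iff,
        forall_eq_or_imp, forall_eq]
      exact ⟨hfadj w hw', mem_of_mem_erase hw', hfS w hw'⟩
    · intro w hw z hz hwz
      have hw' := hfdist w (mem_coe.1 hw)
      have hz' := hfdist z (mem_coe.1 hz)
      rcases Sym2.eq_iff.1 hwz with h1 | ⟨h1, h2⟩
      · exact h1.1
      · rw [h2] at hw'
        rw [← h1] at hz'
        omega
  rw [card_erase_of_mem h.mem] at hle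
  omega

end IsCut

/-- In a tree every edge is the only edge between the two sets of vertices closer to its ends. -/
theorem isCut_side {T : SimpleGraph V} (hT : T.IsTree) {u v : V} (h : T.Adj u v) :
    IsCut T (side T u v) u v := by
  have hb := (isAcyclic_iff_forall_adj_isBridge.1 hT.isAcyclic) h
  rw [isBridge_iff] at hb
  set H := T.deleteEdges {s(u, v)} with hH
  -- The edge is a bridge, so the component of `u` after its deletion is a cut; it must be the side
  -- of `u`.
  have hcut : IsCut T ({w | H.Reachable u w} : Finset V) u v := by
    refine ⟨h, by simp, by simpa using hb, ?_⟩
    intro x hx y hy hxy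
    simp only [mem_filter, mem_univ, true_and] at hx hy
    by_cases he : s(x, y) = s(u, v)
    · rcases Sym2.eq_iff.1 he with h1 | ⟨rfl, rfl⟩
      · exact h1
      · exact absurd hx hb
    · refine absurd (hx.trans (Adj.reachable ?_)) hy
      rw [hH, deleteEdges_adj]
      exact ⟨hxy, by simpa using he⟩
  rwa [hcut.eq_side hT.connected] at hcut

theorem side_compl {T : SimpleGraph V} (hT : T.IsTree) {u v : V} (h : T.Adj u v) :
    (side T u v)ᶜ = side T v u :=
  (isCut_side hT h).compl.eq_side hT.connected

/-- For an edge `xy` inside one side of an edge `uv`, one of the two sides of `xy` is a proper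
subset of that side of `uv`. -/
theorem side_ssubset_of_mem {T : SimpleGraph V} (hT : T.IsTree) {u v x y : V} (huv : T.Adj u v)
    (hxy : T.Adj x y) (hx : x ∈ side T u v) (hy : y ∈ side T u v) (hu : u ∉ side T x y) :
    side T x y ⊂ side T u v := by
  have hS := isCut_side hT huv
  have hZ := isCut_side hT hxy
  refine ⟨fun w hw => ?_, fun hsub => hZ.notMem (hsub hy)⟩
  by_contra hwS
  -- If the part of the `xy`-side outside the `uv`-side were nonempty, it would be closed under
  -- adjacency: leaving the first set happens only at `x`, and entering the second only at `u`, both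
  -- of which are excluded. It would then contain `u`.
  refine absurd (mem_of_adj_closed hT.connected {z | z ∈ side T x y ∧ z ∉ side T u v}
    ⟨hw, hwS⟩ ?_ u).1 hu
  rintro z ⟨hz1, hz2⟩ z' hzz'
  have h1 : z' ∈ side T x y := by
    by_contra hc
    exact hz2 ((hZ.unique _ hz1 _ hc hzz').1 ▸ hx)
  refine ⟨h1, fun hc => hu ?_⟩
  exact (hS.unique _ hc _ hz2 hzz'.symm).1 ▸ h1

/-! ### The Mostar index as a sum of smaller sides, and layer-cake summation -/

/-- The number of vertices on the smaller side of an edge. -/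
noncomputable def smallSide (G : SimpleGraph V) : Sym2 V → ℕ :=
  Sym2.lift ⟨fun u v => min (numCloser G u v) (numCloser G v u), fun _ _ => min_comm _ _⟩

theorem smallSide_mk (G : SimpleGraph V) (u v : V) :
    smallSide G s(u, v) = min #(side G u v) #(side G v u) := by
  simp [smallSide, numCloser_eq_card_side]

theorem card_side_add {T : SimpleGraph V} (hT : T.IsTree) {u v : V} (h : T.Adj u v) :
    #(side T u v) + #(side T v u) = Fintype.card V := by
  rw [← side_compl hT h, card_add_card_compl]

theorem IsCut.smallSide_eq {G : SimpleGraph V} {S : Finset V} {u v : V} (h : IsCut G S u v)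
    (hG : G.Connected) : smallSide G s(u, v) = min #S (Fintype.card V - #S) := by
  rw [smallSide_mk, ← h.eq_side hG, ← h.compl.eq_side hG, card_compl]

/-- The sides of an edge have total size `card V`, so their difference is `card V` minus twice the
smaller one. All trees of one order have equally many edges, so only the last sum varies. -/
theorem mostarIndex_eq {T : SimpleGraph V} (hT : T.IsTree) :
    mostarIndex T = (Fintype.card V : ℤ) * #T.edgeFinset
      - 2 * ((∑ e ∈ T.edgeFinset, smallSide T e : ℕ) : ℤ) := by
  have h : ∀ e ∈ T.edgeFinset,
      edgeContribution T e = (Fintype.card V : ℤ) - 2 * (smallSide T e : ℤ) := by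
    intro e
    induction e using Sym2.ind with
    | _ u v =>
      intro he
      have h1 := card_side_add hT (mem_edgeFinset.1 he)
      have h2 : edgeContribution T s(u, v) = |(#(side T u v) : ℤ) - #(side T v u)| := by
        simp [edgeContribution, numCloser_eq_card_side]
      rw [smallSide_mk, h2]
      simp only at h1
      rcases le_total #(side T u v) #(side T v u) with hle | hle
      · rw [min_eq_left hle, abs_of_nonpos (by omega)]; omega
      · rw [min_eq_right hle, abs_of_nonneg (by omega)]; omega
  rw [mostarIndex, sum_congr rfl h, sum_sub_distrib, sum_const, ← mul_sum]
  push_cast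
  simp [mul_comm]

theorem sum_eq_sum_card_lt {α : Type*} (s : Finset α) (f : α → ℕ) (N : ℕ)
    (hN : ∀ x ∈ s, f x ≤ N) : ∑ x ∈ s, f x = ∑ j ∈ range N, #{x ∈ s | j < f x} := by
  simp_rw [card_filter]
  rw [sum_comm]
  refine sum_congr rfl fun x hx => ?_
  rw [← card_filter]
  have : {j ∈ range N | j < f x} = range (f x) := by
    ext j
    have := hN x hx
    simp only [mem_filter, mem_range]
    omega
  rw [this, card_range]

/-- Layer-cake comparison of two sums of natural numbers. -/
theorem sum_le_sum_of_card_le {α β : Type*} (s : Finset α) (t : Finset β) (f : α → ℕ) (g : β → ℕ)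
    (h : ∀ j, #{x ∈ s | j < f x} ≤ #{x ∈ t | j < g x}) :
    ∑ x ∈ s, f x ≤ ∑ x ∈ t, g x ∧
      (∑ x ∈ s, f x = ∑ x ∈ t, g x → ∀ j, #{x ∈ s | j < f x} = #{x ∈ t | j < g x}) := by
  set N := s.sup f + t.sup g
  have h1 := sum_eq_sum_card_lt s f N fun x hx => (le_sup hx).trans (Nat.le_add_right _ _)
  have h2 := sum_eq_sum_card_lt t g N fun x hx => (le_sup hx).trans (Nat.le_add_left _ _)
  rw [h1, h2]
  refine ⟨sum_le_sum fun j _ => h j, fun heq j => ?_⟩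
  by_cases hj : j < N
  · exact (sum_eq_sum_iff_of_le fun j _ => h j).1 heq j (mem_range.2 hj)
  · rw [filter_false_of_mem, filter_false_of_mem]
    · rfl
    · intro x hx hlt
      have : g x ≤ t.sup g := le_sup hx
      omega
    · intro x hx hlt
      have : f x ≤ s.sup f := le_sup hx
      omega

end Mostar

/-! ### Families of arms, core edges, and the edge count -/

namespace Mostar

open Finset SimpleGraph
open scoped Classical

/-- `w i 0, …, w i r` for `i : ι` are paths of `G`, pairwise disjoint up to their last vertices,
such that the first `r` vertices of each path have no neighbours outside of the path. -/
structure IsArmFamily {V ι : Type*} (G : SimpleGraph V) (r : ℕ) (w : ι → ℕ → V) : Prop where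
  adj : ∀ i t, t < r → G.Adj (w i t) (w i (t + 1))
  nbr : ∀ i t x, t < r → G.Adj (w i t) x → x = w i (t + 1) ∨ ∃ t', t' + 1 = t ∧ x = w i t'
  inj : ∀ i t i' t', t ≤ r → t' < r → w i t = w i' t' → i = i' ∧ t = t'

namespace IsArmFamily

variable {V ι : Type*} {G : SimpleGraph V} {r : ℕ} {w : ι → ℕ → V}

theorem injOn_edge (h : IsArmFamily G r w) (s : Finset ι) :
    Set.InjOn (fun a : ι × ℕ => s(w a.1 a.2, w a.1 (a.2 + 1))) (s ×ˢ range r : Finset (ι × ℕ)) := by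
  rintro ⟨i, t⟩ ha ⟨i', t'⟩ ha' heq
  simp only [coe_product, Set.mem_prod, mem_coe, mem_range] at ha ha'
  rcases Sym2.eq_iff.1 heq with ⟨h1, -⟩ | ⟨h1, h2⟩
  · obtain ⟨h3, h4⟩ := h.inj _ _ _ _ ha.2.le ha'.2 h1
    exact Prod.ext h3 h4
  · obtain ⟨-, h3⟩ := h.inj _ _ _ _ ha'.2 ha.2 h1.symm
    obtain ⟨-, h4⟩ := h.inj _ _ _ _ ha.2 ha'.2 h2
    omega

theorem isCut_initial (h : IsArmFamily G r w) (i : ι) {t : ℕ} (ht : t < r) :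
    IsCut G ((range (t + 1)).image (w i)) (w i t) (w i (t + 1)) := by
  refine ⟨h.adj i t ht, mem_image_of_mem _ (by simp), ?_, ?_⟩
  · rw [mem_image]
    rintro ⟨s, hs, heq⟩
    rw [mem_range] at hs
    have := (h.inj _ _ _ _ (by omega) (by omega) heq.symm).2
    omega
  · intro x hx y hy hxy
    simp only [mem_image, mem_range, not_exists, not_and] at hx hy
    obtain ⟨s, hs, rfl⟩ := hx
    rcases h.nbr _ _ _ (by omega) hxy with h1 | ⟨t', h1, h2⟩
    · have : s = t := by
        by_contra hne
        exact hy (s + 1) (by omega) h1.symm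
      rw [h1, this]
      exact ⟨rfl, rfl⟩
    · exact absurd h2.symm (hy t' (by omega))

theorem card_initial (h : IsArmFamily G r w) (i : ι) {t : ℕ} (ht : t < r) :
    #((range (t + 1)).image (w i)) = t + 1 := by
  rw [card_image_of_injOn, card_range]
  intro a ha b hb hab
  simp only [coe_range, Set.mem_Iio] at ha hb
  exact (h.inj _ _ _ _ (by omega) (by omega) hab).2

/-- The number of vertices of a set of arms without their last vertices. -/
theorem card_image_arms (h : IsArmFamily G r w) (s : Finset ι) :
    #((s ×ˢ range r).image fun a => w a.1 a.2) = #s * r := by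
  rw [card_image_of_injOn, card_product, card_range]
  rintro ⟨i, t⟩ ha ⟨i', t'⟩ ha' heq
  simp only [coe_product, Set.mem_prod, mem_coe, mem_range] at ha ha'
  exact Prod.ext_iff.2 (h.inj _ _ _ _ ha.2.le ha'.2 heq)

end IsArmFamily

variable {V ι : Type*} [Fintype V] [Fintype ι]

/-- The edges of the paths of a family. -/
noncomputable def armEdges (r : ℕ) (w : ι → ℕ → V) : Finset (Sym2 V) :=
  (univ ×ˢ range r).image fun a : ι × ℕ => s(w a.1 a.2, w a.1 (a.2 + 1))

/-- The edges of `G` outside of the paths of a family. -/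
noncomputable def coreEdges (G : SimpleGraph V) (r : ℕ) (w : ι → ℕ → V) : Finset (Sym2 V) :=
  G.edgeFinset \ armEdges r w

theorem mem_coreEdges {G : SimpleGraph V} {r : ℕ} {w : ι → ℕ → V} {e : Sym2 V} :
    e ∈ coreEdges G r w ↔ e ∈ G.edgeSet ∧ e ∉ armEdges r w := by
  rw [coreEdges, mem_sdiff, mem_edgeFinset]

namespace IsArmFamily

variable {G : SimpleGraph V} {r : ℕ} {w : ι → ℕ → V}

theorem armEdges_subset (h : IsArmFamily G r w) : armEdges r w ⊆ G.edgeFinset := by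
  intro e he
  simp only [armEdges, mem_image, mem_product, mem_univ, true_and, mem_range] at he
  obtain ⟨⟨i, t⟩, ht, rfl⟩ := he
  exact mem_edgeFinset.2 (h.adj i t ht)

/-- All edges at one of the first `r` vertices of an arm belong to that arm. -/
theorem notMem_of_mem_coreEdges (h : IsArmFamily G r w) {x y : V} (he : s(x, y) ∈ coreEdges G r w)
    (i : ι) {t : ℕ} (ht : t < r) : x ≠ w i t := by
  rintro rfl
  obtain ⟨h1, h2⟩ := mem_sdiff.1 he
  refine h2 ?_
  simp only [armEdges, mem_image, mem_product, mem_univ, true_and, mem_range]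
  rcases h.nbr _ _ _ ht (mem_edgeFinset.1 h1) with h3 | ⟨t', h3, h4⟩
  · exact ⟨(i, t), ht, by simp only at h3; simp [h3]⟩
  · refine ⟨(i, t'), by simp only; omega, ?_⟩
    simp only at h4
    simp [h3, h4, Sym2.eq_swap]

/-- The initial segments of an arm are cuts of known size, so the contribution of the arms does not
depend on the rest of the graph. -/
theorem sum_armEdges (h : IsArmFamily G r w) (hG : G.Connected) :
    ∑ e ∈ armEdges r w, smallSide G e =
      Fintype.card ι * ∑ t ∈ range r, min (t + 1) (Fintype.card V - (t + 1)) := by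
  rw [armEdges, sum_image (h.injOn_edge univ), sum_product]
  rw [← smul_eq_mul, ← card_univ, ← sum_const]
  refine sum_congr rfl fun i _ => sum_congr rfl fun t ht => ?_
  rw [(h.isCut_initial i (mem_range.1 ht)).smallSide_eq hG, h.card_initial i (mem_range.1 ht)]

/-- A cut through a core edge crosses no arm edge, so each arm, including its last vertex, lies on
one side. -/
theorem mem_iff_of_isCut (h : IsArmFamily G r w) {S : Finset V} {u v : V} (hS : IsCut G S u v)
    (he : s(u, v) ∈ coreEdges G r w) (i : ι) {t : ℕ} (ht : t ≤ r) : w i t ∈ S ↔ w i 0 ∈ S := by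
  induction t with
  | zero => rfl
  | succ t ih =>
    rw [← ih (by omega)]
    constructor
    · intro h1
      by_contra h2
      refine h.notMem_of_mem_coreEdges (x := v) (y := u) (by rwa [Sym2.eq_swap]) i (t := t)
        (by omega) ?_
      exact (hS.unique _ h1 _ h2 (h.adj i t (by omega)).symm).2.symm
    · intro h1
      by_contra h2
      refine h.notMem_of_mem_coreEdges he i (t := t) (by omega) ?_
      exact (hS.unique _ h1 _ h2 (h.adj i t (by omega))).1.symm

/-- Together with `card_insert_arms` this gives the lower bound `p r + 1` for a side of a core edge
that contains `p` arms; the extra vertex is the end `u` of the edge, which is not among the first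
`r` vertices of any arm. -/
theorem image_arms_subset (h : IsArmFamily G r w) {S : Finset V} {u v : V} (hS : IsCut G S u v)
    (he : s(u, v) ∈ coreEdges G r w) :
    insert u ((({i | w i 0 ∈ S} : Finset ι) ×ˢ range r).image fun a => w a.1 a.2) ⊆ S := by
  refine insert_subset hS.mem fun z hz => ?_
  simp only [mem_image, mem_product, mem_filter, mem_univ, true_and, mem_range] at hz
  obtain ⟨a, ⟨h1, h2⟩, rfl⟩ := hz
  exact (h.mem_iff_of_isCut hS he _ h2.le).2 h1

theorem card_insert_arms (h : IsArmFamily G r w) {u v : V}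
    (he : s(u, v) ∈ coreEdges G r w) (s : Finset ι) :
    #(insert u ((s ×ˢ range r).image fun a => w a.1 a.2)) = #s * r + 1 := by
  rw [card_insert_of_notMem, h.card_image_arms]
  intro hz
  simp only [mem_image, mem_product, mem_range] at hz
  obtain ⟨a, ⟨-, h2⟩, h3⟩ := hz
  exact h.notMem_of_mem_coreEdges he a.1 h2 h3.symm

/-- If a side of a core edge `uv` is not larger than needed for its arms, then all these arms end
at `u`. -/
theorem last_eq_of_card_le (h : IsArmFamily G r w) {S : Finset V} {u v : V} (hS : IsCut G S u v)
    (he : s(u, v) ∈ coreEdges G r w) (hcard : #S ≤ #{i | w i 0 ∈ S} * r + 1) {i : ι}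
    (hi : w i 0 ∈ S) : w i r = u := by
  -- There is room for only one vertex besides the first `r` vertices of the arms. The last vertex
  -- of each arm also lies in `S`, so it must be `u`.
  have heq := eq_of_subset_of_card_le (h.image_arms_subset hS he)
    (by rw [h.card_insert_arms he]; exact hcard)
  have hmem := (h.mem_iff_of_isCut hS he i le_rfl).2 hi
  rw [← heq, mem_insert] at hmem
  refine hmem.resolve_right fun hz => ?_
  simp only [mem_image, mem_product, mem_range] at hz
  obtain ⟨a, ⟨-, h2⟩, h3⟩ := hz
  have := (h.inj _ _ _ _ le_rfl h2 h3.symm).2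
  omega

end IsArmFamily

/-- Every side of an edge of `F` contains a side of an edge of `F` that spans no edge of `F`. -/
theorem exists_minimal_side {T : SimpleGraph V} (hT : T.IsTree) {F : Finset (Sym2 V)}
    (hF : F ⊆ T.edgeFinset) {u v : V} (he : s(u, v) ∈ F) :
    ∃ x y, s(x, y) ∈ F ∧ side T x y ⊆ side T u v ∧ ∀ e ∈ F, ¬ ∀ z ∈ e, z ∈ side T x y := by
  induction hc : #(side T u v) using Nat.strong_induction_on generalizing u v with
  | _ c ih =>
    by_cases hmin : ∀ e ∈ F, ¬ ∀ z ∈ e, z ∈ side T u v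
    · exact ⟨u, v, he, Subset.rfl, hmin⟩
    push Not at hmin
    obtain ⟨e, heF, hes⟩ := hmin
    have step : ∀ a b, s(a, b) ∈ F → side T a b ⊂ side T u v →
        ∃ x y, s(x, y) ∈ F ∧ side T x y ⊆ side T u v ∧ ∀ e ∈ F, ¬ ∀ z ∈ e, z ∈ side T x y := by
      intro a b hab hsub
      obtain ⟨x, y, h1, h2, h3⟩ := ih _ (hc ▸ card_lt_card hsub) hab rfl
      exact ⟨x, y, h1, h2.trans hsub.subset, h3⟩
    induction e using Sym2.ind with
    | _ a b =>
      have huv : T.Adj u v := mem_edgeFinset.1 (hF he)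
      have hab : T.Adj a b := mem_edgeFinset.1 (hF heF)
      have ha := hes a (Sym2.mem_mk_left _ _)
      have hb := hes b (Sym2.mem_mk_right _ _)
      -- Of the two sides of `ab`, the one avoiding `u` is properly contained in the side of `u`.
      by_cases hu : u ∈ side T a b
      · refine step b a (by rwa [Sym2.eq_swap]) (side_ssubset_of_mem hT huv hab.symm hb ha ?_)
        rw [← side_compl hT hab]
        simpa using hu
      · exact step a b heF (side_ssubset_of_mem hT huv hab ha hb hu)

/-- Counting edges: `F` is a set of core edges, none of them inside the disjoint sides `X` and `Y`
of two core edges. -/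
theorem IsArmFamily.card_add_card_le {T : SimpleGraph V} {r : ℕ} {w : ι → ℕ → V} (hT : T.IsTree)
    (h : IsArmFamily T r w) {F : Finset (Sym2 V)} (hF : F ⊆ coreEdges T r w)
    {X Y : Finset V} {x y x' y' : V} (hX : IsCut T X x y) (hxy : s(x, y) ∈ coreEdges T r w)
    (hY : IsCut T Y x' y') (hxy' : s(x', y') ∈ coreEdges T r w) (hdis : Disjoint X Y)
    (hFX : ∀ e ∈ F, ¬ ∀ z ∈ e, z ∈ X) (hFY : ∀ e ∈ F, ¬ ∀ z ∈ e, z ∈ Y) :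
    #F + #X + #Y + Fintype.card ι * r ≤
        Fintype.card V + 1 + (#{i | w i 0 ∈ X} + #{i | w i 0 ∈ Y}) * r ∧
      #{i | w i 0 ∈ X} + #{i | w i 0 ∈ Y} ≤ Fintype.card ι := by
  set EX : Finset (Sym2 V) := {e ∈ T.edgeFinset | ∀ z ∈ e, z ∈ X} with hEX
  set EY : Finset (Sym2 V) := {e ∈ T.edgeFinset | ∀ z ∈ e, z ∈ Y} with hEY
  set IX : Finset ι := {i | w i 0 ∈ X} with hIX
  set IY : Finset ι := {i | w i 0 ∈ Y} with hIY
  have hI : Disjoint IX IY := by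
    rw [Finset.disjoint_left]
    intro i h1 h2
    simp only [hIX, hIY, mem_filter, mem_univ, true_and] at h1 h2
    exact Finset.disjoint_left.1 hdis h1 h2
  have hIcard : #IX + #IY + #(IX ∪ IY)ᶜ = Fintype.card ι := by
    rw [← card_union_of_disjoint hI, card_add_card_compl]
  -- The edges of the arms that lie in neither `X` nor `Y`.
  set R : Finset (Sym2 V) :=
    ((IX ∪ IY)ᶜ ×ˢ range r).image (fun a : ι × ℕ => s(w a.1 a.2, w a.1 (a.2 + 1))) with hR
  have hRcard : #R = #(IX ∪ IY)ᶜ * r := by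
    rw [hR, card_image_of_injOn (h.injOn_edge _), card_product, card_range]
  have hRmem : ∀ e ∈ R, e ∈ armEdges r w ∧ (¬ ∀ z ∈ e, z ∈ X) ∧ ¬ ∀ z ∈ e, z ∈ Y := by
    intro e he
    rw [hR, mem_image] at he
    obtain ⟨⟨i, t⟩, ha, rfl⟩ := he
    simp only [hIX, hIY, mem_product, mem_compl, mem_union, mem_filter, mem_univ, true_and,
      not_or, mem_range] at ha
    refine ⟨?_, fun hc => ha.1.1 ?_, fun hc => ha.1.2 ?_⟩
    · exact mem_image.2 ⟨(i, t), by simpa using ha.2, rfl⟩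
    · exact (h.mem_iff_of_isCut hX hxy i ha.2.le).1 (hc _ (Sym2.mem_mk_left _ _))
    · exact (h.mem_iff_of_isCut hY hxy' i ha.2.le).1 (hc _ (Sym2.mem_mk_left _ _))
  have d1 : Disjoint EX EY := by
    rw [Finset.disjoint_left]
    intro e h1 h2
    induction e using Sym2.ind with
    | _ a b =>
      exact Finset.disjoint_left.1 hdis ((mem_filter.1 h1).2 a (Sym2.mem_mk_left _ _))
        ((mem_filter.1 h2).2 a (Sym2.mem_mk_left _ _))
  have d2 : Disjoint F R := by
    rw [Finset.disjoint_left]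
    intro e h1 h2
    exact (mem_sdiff.1 (hF h1)).2 (hRmem e h2).1
  have d3 : Disjoint (EX ∪ EY) (F ∪ R) := by
    rw [Finset.disjoint_left]
    intro e h1 h2
    rcases mem_union.1 h1 with h1 | h1 <;> rcases mem_union.1 h2 with h2 | h2
    · exact hFX e h2 (mem_filter.1 h1).2
    · exact (hRmem e h2).2.1 (mem_filter.1 h1).2
    · exact hFY e h2 (mem_filter.1 h1).2
    · exact (hRmem e h2).2.2 (mem_filter.1 h1).2
  -- Four disjoint sets of edges share the `card V - 1` edges of the tree, and the first two have at
  -- least `#X - 1` and `#Y - 1` elements.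
  have hsub : (EX ∪ EY) ∪ (F ∪ R) ⊆ T.edgeFinset := by
    refine union_subset (union_subset (filter_subset _ _) (filter_subset _ _))
      (union_subset (hF.trans sdiff_subset) fun e he => h.armEdges_subset (hRmem e he).1)
  have hle := card_le_card hsub
  rw [card_union_of_disjoint d3, card_union_of_disjoint d1, card_union_of_disjoint d2, hRcard]
    at hle
  have hE := hT.card_edgeFinset
  have h1 := hX.card_le_card_edges_inside hT.connected
  have h2 := hY.card_le_card_edges_inside hT.connected
  rw [← hEX] at h1
  rw [← hEY] at h2
  refine ⟨?_, by omega⟩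
  rw [← hIcard, add_mul (#IX + #IY)]
  omega

end Mostar

/-! ### The bound on each level -/

namespace Mostar

open Finset SimpleGraph
open scoped Classical

/-- A bijective homomorphism from a connected graph to a tree is an isomorphism. -/
theorem nonempty_iso_of_bijective {V W : Type*} {G : SimpleGraph W} {T : SimpleGraph V}
    (hG : G.Connected) (hT : T.IsTree) (f : W → V) (hf : Function.Bijective f)
    (h : ∀ x y, G.Adj x y → T.Adj (f x) (f y)) : Nonempty (T ≃g G) := by
  let e := Equiv.ofBijective f hf
  let i : T.comap e ≃g T := Iso.comap e T
  -- The pulled back tree is a minimal connected graph and contains the connected graph `G`, so the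
  -- two coincide.
  have hmin := isTree_iff_minimal_connected.1 (i.isTree_iff.2 hT)
  have hle : G ≤ T.comap e := fun x y hxy => h x y hxy
  have heq : T.comap e = G := le_antisymm (hmin.2 hG hle) hle
  exact ⟨heq ▸ i.symm⟩

/-- Counts the edges of the central path of the extremal tree on level `j`: edge `i` has `a r + i +
1` vertices on one side and `b r + (m - 1 - i)` on the other, so the qualifying `i` form an
interval. Truncated subtraction covers the low levels, where an end imposes no restriction. -/
theorem card_filter_lt_min (m r a b j : ℕ) :
    #{i ∈ range (m - 1) | j < min (a * r + i + 1) (b * r + (m - 1 - i))} =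
      min (m - 1) (b * r + m - 1 - j) - (j - a * r) := by
  have : {i ∈ range (m - 1) | j < min (a * r + i + 1) (b * r + (m - 1 - i))} =
      Ico (j - a * r) (min (m - 1) (b * r + m - 1 - j)) := by
    ext i
    simp only [mem_filter, mem_range, mem_Ico, lt_min_iff]
    omega
  rw [this, Nat.card_Ico]

variable {V ι : Type*} [Fintype V] [Fintype ι]

theorem smallSide_le_card_side (T : SimpleGraph V) (u v : V) :
    smallSide T s(u, v) ≤ #(side T u v) := by
  rw [smallSide_mk]
  exact min_le_left _ _

namespace IsArmFamily

variable {T : SimpleGraph V} {r : ℕ} {w : ι → ℕ → V}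

/-- The two sides of an edge of a set `F` of core edges contain sides `X` and `Y` of edges of `F`
which span no edge of `F`. -/
theorem exists_ends (hT : T.IsTree) (h : IsArmFamily T r w) {F : Finset (Sym2 V)}
    (hF : F ⊆ coreEdges T r w) {u v : V} (he : s(u, v) ∈ F) :
    ∃ x y x' y', s(x, y) ∈ F ∧ s(x', y') ∈ F ∧ side T x y ⊆ side T u v ∧
      side T x' y' ⊆ side T v u ∧ Disjoint (side T x y) (side T x' y') ∧
      #F + #(side T x y) + #(side T x' y') + Fintype.card ι * r ≤ Fintype.card V + 1 +
        (#{i | w i 0 ∈ side T x y} + #{i | w i 0 ∈ side T x' y'}) * r ∧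
      #{i | w i 0 ∈ side T x y} + #{i | w i 0 ∈ side T x' y'} ≤ Fintype.card ι ∧
      #{i | w i 0 ∈ side T x y} * r + 1 ≤ #(side T x y) ∧
      #{i | w i 0 ∈ side T x' y'} * r + 1 ≤ #(side T x' y') := by
  have hFE : F ⊆ T.edgeFinset := hF.trans sdiff_subset
  obtain ⟨x, y, h1, h2, h3⟩ := exists_minimal_side hT hFE he
  obtain ⟨x', y', h1', h2', h3'⟩ := exists_minimal_side hT hFE (u := v) (v := u)
    (by rwa [Sym2.eq_swap])
  have huv : T.Adj u v := mem_edgeFinset.1 (hFE he)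
  have hX := isCut_side hT (mem_edgeFinset.1 (hFE h1) : T.Adj x y)
  have hY := isCut_side hT (mem_edgeFinset.1 (hFE h1') : T.Adj x' y')
  have hdis : Disjoint (side T x y) (side T x' y') := by
    refine disjoint_of_subset_left h2 (disjoint_of_subset_right h2' ?_)
    rw [← side_compl hT huv]
    exact disjoint_compl_right
  obtain ⟨h4, h5⟩ := h.card_add_card_le hT hF hX (hF h1) hY (hF h1') hdis h3 h3'
  refine ⟨x, y, x', y', h1, h1', h2, h2', hdis, h4, h5, ?_, ?_⟩
  · rw [← h.card_insert_arms (hF h1)]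
    exact card_le_card (h.image_arms_subset hX (hF h1))
  · rw [← h.card_insert_arms (hF h1')]
    exact card_le_card (h.image_arms_subset hY (hF h1'))

/-- The heart of the proof. By `exists_ends`, the level set has at most `m + 1 - (#X - p r) - (#Y -
q r)` edges, where `p` and `q` arms lie in the end sides `X` and `Y`. Each bracket is at least `1`
and at least `j + 1 - p r` or `j + 1 - q r` respectively. Under `p + q ≤ a + b` the resulting bound
is largest for the balanced split. -/
theorem card_level_le (hT : T.IsTree) (h : IsArmFamily T r w) {m a b : ℕ}
    (hι : Fintype.card ι = a + b) (hn : Fintype.card V = m + (a + b) * r) (hab : a ≤ b + 1)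
    (hba : b ≤ a + 1) (j : ℕ) :
    #{e ∈ coreEdges T r w | j < smallSide T e} ≤
      min (m - 1) (b * r + m - 1 - j) - (j - a * r) := by
  set F := {e ∈ coreEdges T r w | j < smallSide T e} with hFdef
  rcases F.eq_empty_or_nonempty with hF | ⟨e, he⟩
  · simp [hF]
  induction e using Sym2.ind with
  | _ u v =>
    obtain ⟨x, y, x', y', h1, h1', -, -, -, h4, h5, h6, h7⟩ :=
      h.exists_ends hT (filter_subset _ _) he
    have h8 := (mem_filter.1 h1).2.trans_le (smallSide_le_card_side T x y)
    have h9 := (mem_filter.1 h1').2.trans_le (smallSide_le_card_side T x' y')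
    rw [← hFdef] at h4
    set p := #{i | w i 0 ∈ side T x y}
    set q := #{i | w i 0 ∈ side T x' y'}
    rw [hι, hn] at h4
    rw [hι] at h5
    -- Since `a` and `b` differ by at most one, `p` and `q` cannot both exceed the smaller of them.
    have h10 : (p ≤ a ∧ p ≤ b) ∨ (q ≤ a ∧ q ≤ b) := by omega
    have h11 := Nat.mul_le_mul_right r h5
    rw [add_mul] at h4 h11
    rw [add_mul] at h4 h11
    rcases h10 with ⟨ha, hb⟩ | ⟨ha, hb⟩ <;>
    · have ha' := Nat.mul_le_mul_right r ha
      have hb' := Nat.mul_le_mul_right r hb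
      omega

theorem card_coreEdges (hT : T.IsTree) (h : IsArmFamily T r w) {m : ℕ}
    (hn : Fintype.card V = m + Fintype.card ι * r) : #(coreEdges T r w) = m - 1 := by
  have h1 := hT.card_edgeFinset
  rw [coreEdges, card_sdiff_of_subset h.armEdges_subset, armEdges,
    card_image_of_injOn (h.injOn_edge univ), card_product, card_range, card_univ]
  omega

theorem sum_smallSide (h : IsArmFamily T r w) (hG : T.Connected) :
    ∑ e ∈ T.edgeFinset, smallSide T e = ∑ e ∈ coreEdges T r w, smallSide T e +
      Fintype.card ι * ∑ t ∈ range r, min (t + 1) (Fintype.card V - (t + 1)) := by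
  rw [← h.sum_armEdges hG, coreEdges, sum_sdiff h.armEdges_subset]

end IsArmFamily

end Mostar

/-! ### The trees `aTree`: arms, central path, sums of smaller sides -/

namespace Mostar

open Finset SimpleGraph
open scoped Classical

/-- A connected graph is a tree if each of its edges is the only edge leaving some set. -/
theorem isTree_of_isCut {V : Type*} {G : SimpleGraph V} (hG : G.Connected)
    (h : ∀ e ∈ G.edgeSet, ∃ S u v, e = s(u, v) ∧ IsCut G S u v) : G.IsTree := by
  refine ⟨hG, isAcyclic_iff_forall_isBridge.2 fun e he => ?_⟩
  obtain ⟨S, u, v, rfl, hS⟩ := h e he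
  rw [isBridge_iff]
  rintro ⟨p⟩
  obtain ⟨d, -, h1, h2⟩ := p.exists_boundary_dart S hS.mem hS.notMem
  have hd := d.adj
  rw [deleteEdges_adj] at hd
  obtain ⟨e1, e2⟩ := hS.unique _ h1 _ h2 hd.1
  exact hd.2 (by rw [e1, e2]; rfl)

section ATree

variable {n r a b : ℕ}

theorem aTree_adj_inl_inl (i j : Fin (n - (a + b) * r)) :
    (aTree n r a b).Adj (.inl i) (.inl j) ↔ i.val + 1 = j.val ∨ j.val + 1 = i.val := by
  simp only [aTree, fromRel_adj, aRel, ne_eq, Sum.inl.injEq, Fin.ext_iff]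
  omega

theorem aTree_adj_inr_inr (p q : Fin a ⊕ Fin b) (i j : Fin r) :
    (aTree n r a b).Adj (.inr (p, i)) (.inr (q, j)) ↔
      p = q ∧ (i.val + 1 = j.val ∨ j.val + 1 = i.val) := by
  simp only [aTree, fromRel_adj, aRel, ne_eq, Sum.inr.injEq, Prod.mk.injEq, Fin.ext_iff]
  constructor
  · rintro ⟨-, ⟨h1, h2⟩ | ⟨h1, h2⟩⟩
    · exact ⟨h1, .inl h2⟩
    · exact ⟨h1.symm, .inr h2⟩
  · rintro ⟨rfl, h⟩
    refine ⟨by omega, ?_⟩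
    simpa using h

/-- The vertex of the central path at which the path `p` is attached. -/
def aRoot (hm : (a + b) * r + 2 ≤ n) : Fin a ⊕ Fin b → Fin (n - (a + b) * r)
  | .inl _ => ⟨0, by omega⟩
  | .inr _ => ⟨n - (a + b) * r - 1, by omega⟩

theorem aTree_adj_inl_inr (hm : (a + b) * r + 2 ≤ n) (i : Fin (n - (a + b) * r))
    (p : Fin a ⊕ Fin b) (j : Fin r) :
    (aTree n r a b).Adj (.inl i) (.inr (p, j)) ↔ i = aRoot hm p ∧ j.val = 0 := by
  have := i.isLt
  rcases p with p | p <;>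
    simp only [aTree, fromRel_adj, aRel, aRoot, ne_eq, reduceCtorEq, not_false_eq_true, true_and,
      or_false, Fin.ext_iff]
  omega

/-- The attached paths, each listed from its leaf to the central path. -/
def aArm (hm : (a + b) * r + 2 ≤ n) (p : Fin a ⊕ Fin b) (t : ℕ) : AVertex n r a b :=
  if h : t < r then .inr (p, ⟨r - 1 - t, by omega⟩) else .inl (aRoot hm p)

theorem isArmFamily_aArm (hm : (a + b) * r + 2 ≤ n) :
    IsArmFamily (aTree n r a b) r (aArm hm) := by
  refine ⟨?_, ?_, ?_⟩
  · intro p t ht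
    by_cases h : t + 1 < r
    · simp only [aArm, ht, h, dite_true, aTree_adj_inr_inr, true_and]
      omega
    · simp only [aArm, ht, h, dite_true, dite_false]
      rw [SimpleGraph.adj_comm, aTree_adj_inl_inr hm]
      exact ⟨rfl, by simp only; omega⟩
  · rintro p t (i | ⟨q, j⟩) ht hadj
    · simp only [aArm, ht, dite_true] at hadj
      rw [SimpleGraph.adj_comm, aTree_adj_inl_inr hm] at hadj
      left
      simp only at hadj
      rw [aArm, dif_neg (by omega), hadj.1]
    · simp only [aArm, ht, dite_true, aTree_adj_inr_inr] at hadj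
      obtain ⟨rfl, h | h⟩ := hadj
      · right
        have := j.isLt
        refine ⟨r - 1 - j.val, by omega, ?_⟩
        simp only [aArm, show r - 1 - j.val < r by omega, dite_true, Sum.inr.injEq, Prod.mk.injEq,
          true_and, Fin.ext_iff]
        omega
      · left
        have := j.isLt
        simp only [aArm, show t + 1 < r by omega, dite_true, Sum.inr.injEq, Prod.mk.injEq,
          true_and, Fin.ext_iff]
        omega
  · intro p t q s ht hs heq
    by_cases h : t < r
    · simp only [aArm, h, hs, dite_true, Sum.inr.injEq, Prod.mk.injEq, Fin.ext_iff] at heq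
      exact ⟨heq.1, by omega⟩
    · simp [aArm, h, hs] at heq

theorem card_aVertex (hm : (a + b) * r + 2 ≤ n) : Fintype.card (AVertex n r a b) = n := by
  simp only [Fintype.card_sum, Fintype.card_prod, Fintype.card_fin]
  omega

theorem aTree_connected (hm : (a + b) * r + 2 ≤ n) : (aTree n r a b).Connected := by
  have h1 : ∀ (t : ℕ) (ht : t < n - (a + b) * r),
      (aTree n r a b).Reachable (.inl ⟨0, by omega⟩) (.inl ⟨t, ht⟩) := by
    intro t
    induction t with
    | zero => intro _; exact Reachable.refl _
    | succ t ih =>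
      intro ht
      exact (ih (by omega)).trans ((aTree_adj_inl_inl _ _).2 (by simp)).reachable
  have h2 : ∀ (p : Fin a ⊕ Fin b) (t : ℕ) (ht : t < r),
      (aTree n r a b).Reachable (.inl ⟨0, by omega⟩) (.inr (p, ⟨t, ht⟩)) := by
    intro p t
    induction t with
    | zero =>
      intro ht
      exact (h1 _ (aRoot hm p).isLt).trans ((aTree_adj_inl_inr hm _ _ _).2 ⟨rfl, rfl⟩).reachable
    | succ t ih =>
      intro ht
      exact (ih (by omega)).trans ((aTree_adj_inr_inr _ _ _ _).2 (by simp)).reachable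
  rw [connected_iff_exists_forall_reachable]
  refine ⟨.inl ⟨0, by omega⟩, ?_⟩
  rintro (⟨t, ht⟩ | ⟨p, ⟨t, ht⟩⟩)
  · exact h1 t ht
  · exact h2 p t ht

/-- An edge of the central path. -/
def aCentralEdge (i : Fin (n - (a + b) * r - 1)) : Sym2 (AVertex n r a b) :=
  s(.inl ⟨i.val, by omega⟩, .inl ⟨i.val + 1, by omega⟩)

theorem aCentralEdge_injective :
    Function.Injective (aCentralEdge : Fin (n - (a + b) * r - 1) → Sym2 (AVertex n r a b)) := by
  intro i j hij
  rcases Sym2.eq_iff.1 hij with ⟨h1, -⟩ | ⟨h1, h2⟩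
  · simpa [Fin.ext_iff] using h1
  · simp only [Sum.inl.injEq, Fin.mk.injEq] at h1 h2
    omega

theorem coreEdges_aTree (hm : (a + b) * r + 2 ≤ n) :
    coreEdges (aTree n r a b) r (aArm hm) = univ.image aCentralEdge := by
  have hfam := isArmFamily_aArm (n := n) (r := r) (a := a) (b := b) hm
  have harm : ∀ x y, s(x, y) ∈ coreEdges (aTree n r a b) r (aArm hm) → ∃ i, x = .inl i := by
    rintro (i | ⟨p, j⟩) y hxy
    · exact ⟨i, rfl⟩
    · refine absurd ?_ (hfam.notMem_of_mem_coreEdges hxy p (t := r - 1 - j.val)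
        (by have := j.isLt; omega))
      have := j.isLt
      simp only [aArm, show r - 1 - j.val < r by omega, dite_true, Sum.inr.injEq, Prod.mk.injEq,
        true_and, Fin.ext_iff]
      omega
  ext e
  induction e using Sym2.ind with
  | _ x y =>
    constructor
    · intro hxy
      obtain ⟨i, rfl⟩ := harm x y hxy
      obtain ⟨j, rfl⟩ := harm y _ (by rwa [Sym2.eq_swap])
      have hadj : (aTree n r a b).Adj (.inl i) (.inl j) := (mem_coreEdges.1 hxy).1
      rw [aTree_adj_inl_inl] at hadj
      have hi := i.isLt
      have hj := j.isLt
      simp only [mem_image, mem_univ, true_and, aCentralEdge]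
      rcases hadj with h | h
      · exact ⟨⟨i.val, by omega⟩, by simp [h]⟩
      · exact ⟨⟨j.val, by omega⟩, by rw [Sym2.eq_swap]; simp [h]⟩
    · intro he
      obtain ⟨i, -, hi⟩ := mem_image.1 he
      rw [← hi, mem_coreEdges, aCentralEdge, mem_edgeSet,
        aTree_adj_inl_inl]
      refine ⟨by simp, fun hc => ?_⟩
      simp only [armEdges, mem_image, mem_product, mem_univ, true_and, mem_range] at hc
      obtain ⟨⟨p, t⟩, ht, heq⟩ := hc
      have hmem := Sym2.mem_mk_left (aArm hm p t) (aArm hm p (t + 1))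
      rw [heq] at hmem
      simp only at ht
      simp [aArm, ht] at hmem

/-- The cut is the initial part of the central path with the `a` arms at its first vertex, so it has
`a r + i + 1` vertices. -/
theorem isCut_aCentralEdge (hm : (a + b) * r + 2 ≤ n) (i : Fin (n - (a + b) * r - 1)) :
    IsCut (aTree n r a b)
      ((Iic (⟨i.val, by omega⟩ : Fin (n - (a + b) * r))).disjSum
        ((univ.map Function.Embedding.inl) ×ˢ univ))
      (.inl ⟨i.val, by omega⟩) (.inl ⟨i.val + 1, by omega⟩) := by
  refine ⟨(aTree_adj_inl_inl _ _).2 (by simp), by simp, by simp, ?_⟩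
  have hi := i.isLt
  rintro (x | ⟨p, x⟩) hx (y | ⟨q, y⟩) hy hxy
  · simp only [inl_mem_disjSum, mem_Iic, Fin.le_def] at hx hy
    rw [aTree_adj_inl_inl] at hxy
    simp only [Sum.inl.injEq, Fin.ext_iff]
    omega
  · rw [aTree_adj_inl_inr hm] at hxy
    simp only [inl_mem_disjSum, mem_Iic, Fin.le_def] at hx
    rcases q with q | q
    · simp at hy
    · rw [hxy.1] at hx
      simp only [aRoot] at hx
      omega
  · rw [SimpleGraph.adj_comm, aTree_adj_inl_inr hm] at hxy
    simp only [inl_mem_disjSum, mem_Iic, Fin.le_def] at hy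
    rcases p with p | p
    · rw [hxy.1] at hy
      simp [aRoot] at hy
    · simp at hx
  · rw [aTree_adj_inr_inr] at hxy
    simp only [inr_mem_disjSum, mem_product, mem_univ, and_true] at hx hy
    exact absurd (hxy.1 ▸ hx) hy

/-- Arm edges are cut by initial segments of arms and central edges by `isCut_aCentralEdge`, so
every edge is a bridge. -/
theorem aTree_isTree (hm : (a + b) * r + 2 ≤ n) : (aTree n r a b).IsTree := by
  refine isTree_of_isCut (aTree_connected hm) fun e he => ?_
  by_cases h : e ∈ armEdges r (aArm hm)
  · simp only [armEdges, mem_image, mem_product, mem_univ, true_and, mem_range] at h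
    obtain ⟨⟨p, t⟩, ht, rfl⟩ := h
    exact ⟨_, _, _, rfl, (isArmFamily_aArm hm).isCut_initial p ht⟩
  · have hc : e ∈ coreEdges (aTree n r a b) r (aArm hm) := mem_coreEdges.2 ⟨he, h⟩
    rw [coreEdges_aTree hm] at hc
    obtain ⟨i, -, rfl⟩ := mem_image.1 hc
    exact ⟨_, _, _, rfl, isCut_aCentralEdge hm i⟩

theorem sum_coreEdges_aTree (hm : (a + b) * r + 2 ≤ n) :
    ∑ e ∈ coreEdges (aTree n r a b) r (aArm hm), smallSide (aTree n r a b) e =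
      ∑ i ∈ range (n - (a + b) * r - 1),
        min (a * r + i + 1) (b * r + (n - (a + b) * r - 1 - i)) := by
  rw [coreEdges_aTree hm, sum_image fun _ _ _ _ h => aCentralEdge_injective h,
    Finset.sum_range]
  refine sum_congr rfl fun i _ => ?_
  rw [aCentralEdge, (isCut_aCentralEdge hm i).smallSide_eq (aTree_connected hm),
    card_aVertex hm]
  have hi := i.isLt
  simp only [card_disjSum, Fin.card_Iic, card_product, card_map, card_univ, Fintype.card_fin]
  have hadd := add_mul a b r
  congr 1 <;> omega

end ATree

end Mostar

/-! ### The case of equality and the comparison theorem -/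

namespace Mostar

open Finset SimpleGraph
open scoped Classical

namespace IsArmFamily

variable {V ι : Type*} [Fintype V] [Fintype ι] {T : SimpleGraph V} {r : ℕ} {w : ι → ℕ → V}

/-- If all arms end at `x` or `y` and no core edge has `x` and `y` on the same side, then the tree
consists of the arms and a path from `x` to `y`. -/
theorem nonempty_iso_of_separated (hT : T.IsTree) (h : IsArmFamily T r w) {n a b : ℕ}
    (hn : Fintype.card V = n) (hm : (a + b) * r + 2 ≤ n) (hι : Fintype.card ι = a + b)
    {x y : V} (σ : Fin a ⊕ Fin b → ι) (hσ : Function.Injective σ)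
    (hσx : ∀ s, w (σ (.inl s)) r = x) (hσy : ∀ s, w (σ (.inr s)) r = y)
    (hx : ∀ i t, t < r → x ≠ w i t) (hy : ∀ i t, t < r → y ≠ w i t)
    (hsep : ∀ u v, s(u, v) ∈ coreEdges T r w → ¬ (x ∈ side T u v ∧ y ∈ side T u v)) :
    Nonempty (T ≃g aTree n r a b) := by
  obtain ⟨p, hp, -⟩ := hT.existsUnique_path x y
  -- The path from `x` to `y` would have to cross the single edge cutting off an initial segment of
  -- an arm twice.
  have hsupp : ∀ z ∈ p.support, ∀ i t, t < r → z ≠ w i t := by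
    rintro z hz i t ht rfl
    refine (h.isCut_initial i ht).notMem_of_mem_support hp ?_ ?_ hz (mem_image_of_mem _ (by simp))
    · intro hc
      obtain ⟨s, hs, hs'⟩ := mem_image.1 hc
      rw [mem_range] at hs
      exact hx i s (by omega) hs'.symm
    · intro hc
      obtain ⟨s, hs, hs'⟩ := mem_image.1 hc
      rw [mem_range] at hs
      exact hy i s (by omega) hs'.symm
  -- Each core edge separates `x` from `y`, so the path uses it. This bounds the length of the path
  -- from below, and disjointness from the arms bounds it from above by the same number.
  have hcore : coreEdges T r w ⊆ p.edges.toFinset := by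
    intro e he
    induction e using Sym2.ind with
    | _ u v =>
      rw [List.mem_toFinset]
      have huv : T.Adj u v := (mem_coreEdges.1 he).1
      have hcut := isCut_side hT huv
      have hs1 := hsep u v he
      have hs2 := hsep v u (by rwa [Sym2.eq_swap])
      rw [← side_compl hT huv, mem_compl, mem_compl] at hs2
      by_cases hxu : x ∈ side T u v
      · exact hcut.mem_edges p hxu fun hc => hs1 ⟨hxu, hc⟩
      · rw [Sym2.eq_swap]
        refine hcut.compl.mem_edges p (mem_compl.2 hxu) fun hc => hs2 ⟨hxu, mem_compl.1 hc⟩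
  have hlen1 : n - (a + b) * r - 1 ≤ p.length := by
    rw [← h.card_coreEdges hT (m := n - (a + b) * r) (by rw [hι]; omega), ← p.length_edges]
    exact (card_le_card hcore).trans (List.toFinset_card_le _)
  have hlen2 : p.length + 1 + (a + b) * r ≤ n := by
    rw [← hn, ← hι, ← card_univ (α := ι), ← h.card_image_arms univ, ← p.length_support,
      ← List.toFinset_card_of_nodup hp.support_nodup, ← card_union_of_disjoint]
    · exact card_le_univ _
    · rw [Finset.disjoint_left]
      intro z hz hz'
      obtain ⟨⟨i, t⟩, ht, rfl⟩ := mem_image.1 hz'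
      simp only [mem_product, mem_univ, true_and, mem_range] at ht
      exact hsupp _ (List.mem_toFinset.1 hz) i t ht rfl
  let f : AVertex n r a b → V :=
    Sum.elim (fun i => p.getVert i.val) (fun q => w (σ q.1) (r - 1 - q.2.val))
  have hinj : Function.Injective f := by
    rintro (i | ⟨q, i⟩) (j | ⟨q', j⟩) hij
    · have hi := i.isLt
      have hj := j.isLt
      have := hp.getVert_injOn (by rw [Set.mem_ofPred_eq]; omega)
        (by rw [Set.mem_ofPred_eq]; omega) hij
      rw [Fin.ext this]
    · have hj := j.isLt
      exact absurd hij (hsupp _ (p.getVert_mem_support _) _ _ (by simp only; omega))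
    · have hi := i.isLt
      exact absurd hij.symm (hsupp _ (p.getVert_mem_support _) _ _ (by simp only; omega))
    · have hi := i.isLt
      have hj := j.isLt
      obtain ⟨h1, h2⟩ := h.inj _ _ _ _ (by simp only; omega) (by simp only; omega) hij
      simp only at h1 h2
      rw [hσ h1, Fin.ext (show i.val = j.val by omega)]
  have hbij : Function.Bijective f := by
    rw [Fintype.bijective_iff_injective_and_card]
    exact ⟨hinj, (card_aVertex hm).trans hn.symm⟩
  have hrel : ∀ x' y', aRel n r a b x' y' → T.Adj (f x') (f y') := by
    have hlast : ∀ q (j : Fin r), j.val = 0 → T.Adj (w q r) (w q (r - 1 - j.val)) := by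
      intro q j hj
      have hjr := j.isLt
      have := (h.adj q (r - 1) (by omega)).symm
      rwa [show r - 1 + 1 = r by omega, show r - 1 = r - 1 - j.val by omega] at this
    rintro (i | ⟨q, i⟩) (j | ⟨q', j⟩) hij
    · have hj := j.isLt
      simp only [aRel] at hij
      simp only [f, Sum.elim_inl, ← hij]
      exact p.adj_getVert_succ (by omega)
    · rcases q' with s | s
      · simp only [aRel] at hij
        simp only [f, Sum.elim_inl, Sum.elim_inr, hij.1, Walk.getVert_zero]
        rw [← hσx s]
        exact hlast _ _ hij.2
      · simp only [aRel] at hij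
        simp only [f, Sum.elim_inl, Sum.elim_inr]
        rw [show i.val = p.length by omega, Walk.getVert_length, ← hσy s]
        exact hlast _ _ hij.2
    · exact absurd hij (by simp [aRel])
    · simp only [aRel] at hij
      have hi := i.isLt
      have hj := j.isLt
      simp only [f, Sum.elim_inr, ← hij.1]
      have := (h.adj (σ q) (r - 1 - j.val) (by omega)).symm
      rwa [show r - 1 - j.val + 1 = r - 1 - i.val by omega] at this
  refine nonempty_iso_of_bijective (aTree_connected hm) hT f hbij fun x' y' hxy => ?_
  rw [aTree, fromRel_adj] at hxy
  rcases hxy.2 with h1 | h1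
  · exact hrel _ _ h1
  · exact (hrel _ _ h1).symm

/-- A tree in which all core edges have large sides is the extremal tree. -/
theorem nonempty_iso_of_lt_smallSide (hT : T.IsTree) (h : IsArmFamily T r w) {n a b : ℕ}
    (hn : Fintype.card V = n) (hm : (a + b) * r + 2 ≤ n) (hι : Fintype.card ι = a + b)
    (hr : 1 ≤ r) (ha : 1 ≤ a) (hb : 1 ≤ b) (hab : a ≤ b + 1) (hba : b ≤ a + 1)
    (h1 : ∀ e ∈ coreEdges T r w, min a b * r < smallSide T e)
    (h2 : a ≠ b → ∀ e ∈ coreEdges T r w, ∀ e' ∈ coreEdges T r w,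
      smallSide T e ≤ min a b * r + 1 → smallSide T e' ≤ min a b * r + 1 → e = e') :
    Nonempty (T ≃g aTree n r a b) := by
  have hcard := h.card_coreEdges hT (m := n - (a + b) * r) (by rw [hι]; omega)
  -- Taking for `F` all `m - 1` core edges makes the edge count tight: each end side has exactly one
  -- vertex more than its arms require. As it has more than `min a b * r` vertices, it holds at
  -- least `min a b` arms.
  have hends : ∀ u v, s(u, v) ∈ coreEdges T r w → ∃ x y x' y', s(x, y) ∈ coreEdges T r w ∧
      s(x', y') ∈ coreEdges T r w ∧ side T x y ⊆ side T u v ∧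
      side T x' y' ⊆ side T v u ∧ Disjoint (side T x y) (side T x' y') ∧
      #(side T x y) = #{i | w i 0 ∈ side T x y} * r + 1 ∧
      #(side T x' y') = #{i | w i 0 ∈ side T x' y'} * r + 1 ∧
      min a b ≤ #{i | w i 0 ∈ side T x y} ∧ min a b ≤ #{i | w i 0 ∈ side T x' y'} ∧
      #{i | w i 0 ∈ side T x y} + #{i | w i 0 ∈ side T x' y'} ≤ a + b := by
    intro u v huv
    obtain ⟨x, y, x', y', k1, k1', k2, k2', k3, k4, k5, k6, k7⟩ :=
      h.exists_ends hT Subset.rfl huv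
    have k8 := (h1 _ k1).trans_le (smallSide_le_card_side T x y)
    have k9 := (h1 _ k1').trans_le (smallSide_le_card_side T x' y')
    refine ⟨x, y, x', y', k1, k1', k2, k2', k3, ?_⟩
    rw [hcard, hι, hn] at k4
    rw [hι] at k5
    rw [add_mul #_] at k4
    have k10 : #(side T x y) = #{i | w i 0 ∈ side T x y} * r + 1 := by omega
    have k11 : #(side T x' y') = #{i | w i 0 ∈ side T x' y'} * r + 1 := by omega
    refine ⟨k10, k11, ?_, ?_, k5⟩
    · exact Nat.le_of_mul_le_mul_right (by omega) hr
    · exact Nat.le_of_mul_le_mul_right (by omega) hr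
  obtain ⟨e, he⟩ : (coreEdges T r w).Nonempty := by
    rw [← card_pos, hcard]; omega
  induction e using Sym2.ind with
  | _ u v =>
  obtain ⟨x, y, x', y', k1, k1', -, -, k3, k4, k4', k5, k5', k6⟩ := hends u v he
  have hX := isCut_side hT (mem_coreEdges.1 k1).1
  have hY := isCut_side hT (mem_coreEdges.1 k1').1
  simp only at hX hY
  have hne : x ≠ x' := fun hc => Finset.disjoint_left.1 k3 hX.mem (hc ▸ hY.mem)
  have hI : Disjoint ({i | w i 0 ∈ side T x y} : Finset ι)
      ({i | w i 0 ∈ side T x' y'} : Finset ι) := by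
    rw [Finset.disjoint_left]
    intro i hi hi'
    simp only [mem_filter, mem_univ, true_and] at hi hi'
    exact Finset.disjoint_left.1 k3 hi hi'
  have hlx : ∀ i, w i 0 ∈ side T x y → w i r = x :=
    fun i hi => h.last_eq_of_card_le hX k1 k4.le hi
  have hly : ∀ i, w i 0 ∈ side T x' y' → w i r = x' :=
    fun i hi => h.last_eq_of_card_le hY k1' k4'.le hi
  set I : Finset ι := {i | w i 0 ∈ side T x y} with hIdef
  set J : Finset ι := {i | w i 0 ∈ side T x' y'} with hJdef
  -- If an arm were missed, both end sides would hold `min a b` arms with `a ≠ b`, and both their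
  -- edges would have smaller side at most `min a b * r + 1`. By `h2` these edges agree, so the
  -- sides are complementary and the tree has too few vertices.
  have hsum : #I + #J = a + b := by
    by_contra hc
    have hab' : a ≠ b := by omega
    have hp : #I = min a b := by omega
    have hq : #J = min a b := by omega
    rw [hp] at k4
    rw [hq] at k4'
    have heq := h2 hab' _ k1 _ k1' (k4 ▸ smallSide_le_card_side T x y)
      (k4' ▸ smallSide_le_card_side T x' y')
    rcases Sym2.eq_iff.1 heq with ⟨e1, -⟩ | ⟨rfl, rfl⟩
    · exact hne e1
    · have hadd := card_side_add hT hX.adj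
      have hab'' : (a + b) * r = 2 * (min a b * r) + r := by
        rw [show a + b = 2 * min a b + 1 by omega]; ring
      omega
  have hcover : ∀ i, i ∈ I ∨ i ∈ J := by
    intro i
    rw [← mem_union]
    have : I ∪ J = univ := by
      rw [← card_eq_iff_eq_univ, card_union_of_disjoint hI, hsum, hι]
    rw [this]; exact mem_univ i
  have hmemI : ∀ i ∈ I, w i r = x := fun i hi => hlx i (mem_filter.1 hi).2
  have hmemJ : ∀ i ∈ J, w i r = x' := fun i hi => hly i (mem_filter.1 hi).2
  have hlast : ∀ i, w i r = x ∨ w i r = x' := fun i => (hcover i).imp (hmemI i) (hmemJ i)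
  -- The opposite side of a core edge contains an end side, hence at least `min a b ≥ 1` arms with
  -- their last vertices. These are `x` or `x'`.
  have hsep : ∀ u v, s(u, v) ∈ coreEdges T r w → ¬ (x ∈ side T u v ∧ x' ∈ side T u v) := by
    rintro u v huv ⟨m1, m2⟩
    obtain ⟨z, t, z', t', -, l1, -, l2, -, -, -, -, l3, -⟩ := hends u v huv
    obtain ⟨i, hi⟩ : ({i | w i 0 ∈ side T z' t'} : Finset ι).Nonempty := by
      rw [← card_pos]; omega
    have huv' : T.Adj u v := (mem_coreEdges.1 huv).1
    have l4 := (mem_filter.1 hi).2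
    have l5 := l2 ((h.mem_iff_of_isCut (isCut_side hT (mem_coreEdges.1 l1).1) l1 i le_rfl).2 l4)
    rw [← side_compl hT huv', mem_compl] at l5
    rcases hlast i with l6 | l6 <;> rw [l6] at l5
    · exact l5 m1
    · exact l5 m2
  have hx : ∀ i t, t < r → x ≠ w i t := fun i t ht => h.notMem_of_mem_coreEdges k1 i ht
  have hy : ∀ i t, t < r → x' ≠ w i t := fun i t ht => h.notMem_of_mem_coreEdges k1' i ht
  have hσ : ∀ {I J : Finset ι} (hI : #I = a) (hJ : #J = b), Disjoint I J →
      Function.Injective (Sum.elim (fun s => ((I.equivFinOfCardEq hI).symm s : ι))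
        (fun s => ((J.equivFinOfCardEq hJ).symm s : ι))) := by
    intro I J hI hJ hd
    refine Function.Injective.sumElim (Subtype.val_injective.comp (Equiv.injective _))
      (Subtype.val_injective.comp (Equiv.injective _)) fun s t hst => ?_
    refine Finset.disjoint_left.1 hd (Subtype.prop ((I.equivFinOfCardEq hI).symm s)) ?_
    rw [hst]
    exact Subtype.prop _
  -- The larger group of arms may sit at either end; in the second case `x` and `x'` exchange roles.
  have hcases : (#I = a ∧ #J = b) ∨ (#J = a ∧ #I = b) := by omega
  rcases hcases with ⟨q1, q2⟩ | ⟨q1, q2⟩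
  · refine h.nonempty_iso_of_separated hT hn hm hι _ (hσ q1 q2 hI)
      (fun s => hmemI _ (Subtype.prop _)) (fun s => hmemJ _ (Subtype.prop _)) hx hy hsep
  · refine h.nonempty_iso_of_separated hT hn hm hι _ (hσ q1 q2 hI.symm)
      (fun s => hmemJ _ (Subtype.prop _)) (fun s => hmemI _ (Subtype.prop _)) hy hx
      fun u v huv hc => hsep u v huv hc.symm

/-- Among all trees of order `n` with a family of `a + b` arms of length `r`, where `a` and `b`
differ by at most one, the tree `aTree n r a b` is the only one with the least Mostar index. -/
theorem mostarIndex_aTree_le (hT : T.IsTree) (h : IsArmFamily T r w) {n a b : ℕ}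
    (hn : Fintype.card V = n) (hm : (a + b) * r + 2 ≤ n) (hι : Fintype.card ι = a + b)
    (hr : 1 ≤ r) (ha : 1 ≤ a) (hb : 1 ≤ b) (hab : a ≤ b + 1) (hba : b ≤ a + 1) :
    mostarIndex (aTree n r a b) ≤ mostarIndex T ∧
      (mostarIndex T = mostarIndex (aTree n r a b) → Nonempty (T ≃g aTree n r a b)) := by
  obtain ⟨m, rfl⟩ : ∃ m, n = m + (a + b) * r := ⟨n - (a + b) * r, by omega⟩
  have hm' : m + (a + b) * r - (a + b) * r = m := by omega
  have hA := aTree_isTree hm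
  have hcardA := card_aVertex hm
  have hEA := hA.card_edgeFinset
  have hET := hT.card_edgeFinset
  have hE : #(aTree (m + (a + b) * r) r a b).edgeFinset = #T.edgeFinset := by omega
  have hlevel := fun j => h.card_level_le hT hι hn hab hba j
  simp_rw [← card_filter_lt_min] at hlevel
  obtain ⟨hle, heq⟩ := sum_le_sum_of_card_le _ _ _ _ hlevel
  have hsumA := (isArmFamily_aArm hm).sum_smallSide (aTree_connected hm)
  have hcoreA : ∑ e ∈ coreEdges (aTree (m + (a + b) * r) r a b) r (aArm hm),
      smallSide (aTree (m + (a + b) * r) r a b) e =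
      ∑ i ∈ range (m - 1), min (a * r + i + 1) (b * r + (m - 1 - i)) := by
    rw [sum_coreEdges_aTree hm, hm']
  rw [hcoreA, hcardA, Fintype.card_sum, Fintype.card_fin, Fintype.card_fin]
    at hsumA
  have hsumT := h.sum_smallSide hT.connected
  rw [hn, hι] at hsumT
  rw [mostarIndex_eq hT, mostarIndex_eq hA, hE, hn, hcardA, hsumA, hsumT]
  refine ⟨by push_cast; linarith, fun hMo => ?_⟩
  have hcount := heq (by push_cast at hMo; zify; linarith)
  simp_rw [card_filter_lt_min] at hcount
  have hcore := h.card_coreEdges hT (m := m) (by rw [hι, hn])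
  have hbr := Nat.mul_le_mul_right r (min_le_right a b)
  have har := Nat.mul_le_mul_right r (min_le_left a b)
  refine h.nonempty_iso_of_lt_smallSide hT hn hm hι hr ha hb hab hba ?_ ?_
  -- On this level the extremal count is still `m - 1`, so every core edge is counted.
  · have h1 := hcount (min a b * r)
    rw [show min (m - 1) (b * r + m - 1 - min a b * r) - (min a b * r - a * r) = m - 1 by omega,
      ← hcore, card_filter_eq_iff] at h1
    exact h1
  · intro hne e he e' he' hs hs'
    -- For `a ≠ b` only the end with fewer arms loses an edge on this level, so exactly one core
    -- edge drops out.
    have h1 := hcount (min a b * r + 1)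
    have hval : min (m - 1) (b * r + m - 1 - (min a b * r + 1)) - (min a b * r + 1 - a * r) =
        m - 2 := by
      rcases (show (a = b + 1 ∧ min a b = b) ∨ (b = a + 1 ∧ min a b = a) by omega) with
        ⟨q1, q2⟩ | ⟨q1, q2⟩
      · rw [q2, q1, add_mul, one_mul]; omega
      · rw [q2, q1, add_mul, one_mul]; omega
    rw [hval] at h1
    have h3 := card_filter_add_card_filter_not (s := coreEdges T r w)
      (fun e => min a b * r + 1 < smallSide T e)
    have h4 : #{e ∈ coreEdges T r w | ¬ min a b * r + 1 < smallSide T e} ≤ 1 := by omega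
    exact card_le_one.1 h4 e (mem_filter.2 ⟨he, by omega⟩) e' (mem_filter.2 ⟨he', by omega⟩)

end IsArmFamily

end Mostar

/-! ### Pendent paths and leaves as families of arms -/

namespace Mostar

open Finset SimpleGraph
open scoped Classical

section Degree

variable {V : Type*} {G : SimpleGraph V}

theorem two_le_degree {v x y : V} [Fintype (G.neighborSet v)] (hx : G.Adj v x) (hy : G.Adj v y)
    (hxy : x ≠ y) : 2 ≤ G.degree v := by
  rw [← card_pair hxy, ← card_neighborFinset_eq_degree]
  refine card_le_card ?_
  simp [insert_subset_iff, hx, hy]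

theorem degree_eq_two {v x y : V} [Fintype (G.neighborSet v)] (hx : G.Adj v x) (hy : G.Adj v y)
    (hxy : x ≠ y) (h : ∀ z, G.Adj v z → z = x ∨ z = y) : G.degree v = 2 := by
  rw [← card_pair hxy, ← card_neighborFinset_eq_degree]
  congr 1
  ext z
  simp only [mem_neighborFinset, mem_insert, mem_singleton]
  exact ⟨h z, by rintro (rfl | rfl) <;> assumption⟩

theorem eq_or_eq_of_degree_eq_two {v x y z : V} [Fintype (G.neighborSet v)] (hx : G.Adj v x)
    (hy : G.Adj v y) (hxy : x ≠ y) (h : G.degree v = 2) (hz : G.Adj v z) : z = x ∨ z = y := by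
  by_contra hc
  push Not at hc
  have h3 : #{x, y, z} = 3 := card_eq_three.2 ⟨x, y, z, hxy, hc.1.symm, hc.2.symm, rfl⟩
  have hsub : {x, y, z} ⊆ G.neighborFinset v := by simp [insert_subset_iff, hx, hy, hz]
  have := card_le_card hsub
  rw [card_neighborFinset_eq_degree] at this
  omega

end Degree

/-- `w 0, …, w r` is a path whose first `r` vertices have no neighbours outside of it. -/
structure IsArm {V : Type*} (G : SimpleGraph V) (r : ℕ) (w : ℕ → V) : Prop where
  adj : ∀ t, t < r → G.Adj (w t) (w (t + 1))
  nbr : ∀ t x, t < r → G.Adj (w t) x → x = w (t + 1) ∨ ∃ t', t' + 1 = t ∧ x = w t'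
  inj : ∀ t t', t ≤ r → t' ≤ r → w t = w t' → t = t'

theorem IsArmFamily.isArm {V ι : Type*} {G : SimpleGraph V} {r : ℕ} {w : ι → ℕ → V}
    (h : IsArmFamily G r w) (i : ι) : IsArm G r (w i) := by
  refine ⟨h.adj i, h.nbr i, fun t t' ht ht' heq => ?_⟩
  rcases ht'.lt_or_eq with h1 | h1
  · exact (h.inj _ _ _ _ ht h1 heq).2
  · rcases ht.lt_or_eq with h2 | h2
    · exact (h.inj _ _ _ _ ht' h2 heq.symm).2.symm
    · omega

namespace IsArm

variable {V : Type*} {G : SimpleGraph V} {r : ℕ} {w w' : ℕ → V}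

/-- An arm is determined by its first vertex. -/
theorem eq_of_start (h : IsArm G r w) (h' : IsArm G r w') (h0 : w 0 = w' 0) {t : ℕ} (ht : t ≤ r) :
    w t = w' t := by
  induction t using Nat.strong_induction_on with
  | _ t ih =>
    rcases t with _ | t
    · exact h0
    · have hadj := h'.adj t (by omega)
      rw [← ih t (by omega) (by omega)] at hadj
      rcases h.nbr t _ (by omega) hadj with h1 | ⟨s, hs, h1⟩
      · exact h1.symm
      · rw [ih s (by omega) (by omega)] at h1
        have := h'.inj _ _ (by omega) (by omega) h1
        omega

variable [Fintype V]

theorem degree_start (h : IsArm G r w) (hr : 1 ≤ r) : G.degree (w 0) = 1 := by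
  rw [degree_eq_one_iff_existsUnique_adj]
  refine ⟨w 1, h.adj 0 hr, fun x hx => ?_⟩
  rcases h.nbr 0 x hr hx with h1 | ⟨s, hs, -⟩
  · exact h1
  · omega

theorem isPendentPath (h : IsArm G r w) (hr : 1 ≤ r) (hend : 2 ≤ G.degree (w r)) :
    IsPendentPath G r fun t => w t.val := by
  refine ⟨hr, ?_, fun i => h.adj i.val i.isLt, h.degree_start hr, hend, ?_⟩
  · intro i j hij
    exact Fin.ext (h.inj _ _ (by omega) (by omega) hij)
  · intro i h0 hl
    simp only [ne_eq, Fin.ext_iff, Fin.val_zero, Fin.val_last] at h0 hl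
    have hi := i.isLt
    obtain ⟨t, ht⟩ : ∃ t, i.val = t + 1 := ⟨i.val - 1, by omega⟩
    suffices hs : ∀ s, s = t + 1 → G.degree (w s) = 2 from hs _ ht
    rintro _ rfl
    refine degree_eq_two (h.adj (t + 1) (by omega)) (h.adj t (by omega)).symm ?_ ?_
    · intro hc
      have := h.inj _ _ (by omega) (by omega) hc
      omega
    · intro z hz
      rcases h.nbr _ _ (by omega) hz with h1 | ⟨s, hs, h1⟩
      · exact .inl h1
      · right
        rw [h1, show s = t by omega]

end IsArm

/-- Degree one at the start and degree two inside leave no room for further neighbours. Indices are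
capped at `r` to obtain a total function on `ℕ`. -/
theorem IsPendentPath.isArm {V : Type*} [Fintype V] {G : SimpleGraph V} {r : ℕ}
    {u : Fin (r + 1) → V} (h : IsPendentPath G r u) :
    IsArm G r fun t => u ⟨min t r, by omega⟩ := by
  obtain ⟨hr, hinj, hadj, h0, -, hmid⟩ := h
  have hadj' : ∀ t, t < r → G.Adj (u ⟨min t r, by omega⟩) (u ⟨min (t + 1) r, by omega⟩) := by
    intro t ht
    convert hadj ⟨t, ht⟩ using 2
    · simp only [Fin.ext_iff, Fin.val_castSucc]; omega
    · simp only [Fin.ext_iff, Fin.val_succ]; omega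
  have hinj' : ∀ t t', t ≤ r → t' ≤ r → u ⟨min t r, by omega⟩ = u ⟨min t' r, by omega⟩ →
      t = t' := by
    intro t t' ht ht' heq
    have := Fin.ext_iff.1 (hinj heq)
    simp only at this
    omega
  refine ⟨hadj', ?_, hinj'⟩
  intro t x ht hx
  rcases t with _ | t
  · left
    have h1 : G.degree (u ⟨min 0 r, by omega⟩) = 1 := by
      convert h0 using 2
      simp
    rw [degree_eq_one_iff_existsUnique_adj] at h1
    exact h1.unique hx (hadj' 0 ht)
  · have h1 := hmid ⟨min (t + 1) r, by omega⟩ (by simp [Fin.ext_iff]; omega)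
      (by simp [Fin.ext_iff]; omega)
    rcases eq_or_eq_of_degree_eq_two (hadj' (t + 1) ht) (hadj' t (by omega)).symm
      (fun hc => by have := hinj' _ _ (by omega) (by omega) hc; omega) h1 hx with h2 | h2
    · exact .inl h2
    · exact .inr ⟨t, rfl, h2⟩

theorem IsPendentPath.eq_of_start {V : Type*} [Fintype V] {G : SimpleGraph V} {r : ℕ}
    {u u' : Fin (r + 1) → V} (h : IsPendentPath G r u) (h' : IsPendentPath G r u')
    (h0 : u 0 = u' 0) : u = u' := by
  funext t
  have := h.isArm.eq_of_start h'.isArm (by simpa using h0) (t := t.val) (by omega)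
  simpa only [show min t.val r = t.val by omega] using this

/-- Distinct arms of length less than half the order are disjoint up to their ends. -/
theorem isArmFamily_of_isArm {V ι : Type*} [Fintype V] {G : SimpleGraph V} (hG : G.Connected)
    {r : ℕ} (hr : 2 * r < Fintype.card V) {w : ι → ℕ → V} (h : ∀ i, IsArm G r (w i))
    (h0 : Function.Injective fun i => w i 0) : IsArmFamily G r w := by
  refine ⟨fun i => (h i).adj, fun i => (h i).nbr, ?_⟩
  intro i t i' t' ht ht' heq
  by_cases hi : i = i'
  · subst hi
    exact ⟨rfl, (h i).inj _ _ ht ht'.le heq⟩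
  exfalso
  -- Consider the first vertex of arm `i` that lies among the first `r` vertices of arm `i'`.
  have hex : ∃ t, t ≤ r ∧ ∃ t' < r, w i t = w i' t' := ⟨t, ht, t', ht', heq⟩
  obtain ⟨hs, s', hs', heq'⟩ := Nat.find_spec hex
  have hmin : ∀ t < Nat.find hex, ∀ t' < r, w i t ≠ w i' t' := by
    intro t htl t' ht' hc
    exact Nat.find_min hex htl ⟨by omega, t', ht', hc⟩
  generalize Nat.find hex = s at hs heq' hmin
  rcases s with _ | s
  · rcases s' with _ | s'
    · exact hi (h0 heq')
    -- The leaf `w i 0` would be an inner vertex of arm `i'`, which has two distinct neighbours.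
    · have h1 : ∀ x, G.Adj (w i 0) x → x = w i 1 := by
        intro x hx
        rcases (h i).nbr 0 x (by omega) hx with h1 | ⟨_, h2, -⟩
        · exact h1
        · omega
      rw [heq'] at h1
      have h2 := h1 _ ((h i').adj (s' + 1) hs')
      rw [← h1 _ ((h i').adj s' (by omega)).symm] at h2
      have := (h i').inj _ _ (by omega) (by omega) h2
      omega
  -- The predecessor on arm `i` is a neighbour on arm `i'`; by minimality it can only be the last
  -- vertex there. So the two arms run through each other in opposite directions.
  · have hlast : w i s = w i' r := by
      have hadj := ((h i).adj s (by omega)).symm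
      rw [heq'] at hadj
      rcases (h i').nbr s' _ hs' hadj with h1 | ⟨q, hq, h1⟩
      · have : s' + 1 = r := by
          by_contra hc
          exact hmin s (by omega) (s' + 1) (by omega) h1
        rw [h1, this]
      · exact absurd h1 (hmin s (by omega) q (by omega))
    -- Both arms together are closed under adjacency, so the graph has at most `s + 1 + r ≤ 2 r`
    -- vertices.
    have hall : ∀ z, z ∈ (range (s + 1)).image (w i) ∪ (range r).image (w i') := by
      refine mem_of_adj_closed hG
        (((range (s + 1)).image (w i) ∪ (range r).image (w i') : Finset V) : Set V) (x := w i 0)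
        (by simp only [coe_union, coe_image, Set.mem_union, Set.mem_image, mem_coe, mem_range]
            exact .inl ⟨0, by omega, rfl⟩) ?_
      intro y hy z hz
      simp only [coe_union, coe_image, Set.mem_union, Set.mem_image, mem_coe, mem_range] at hy ⊢
      rcases hy with ⟨q, hq, rfl⟩ | ⟨q, hq, rfl⟩
      · rcases (h i).nbr q z (by omega) hz with h1 | ⟨q', h1, h2⟩
        · by_cases hqs : q = s
          · exact .inr ⟨s', hs', by rw [h1, hqs, heq']⟩
          · exact .inl ⟨q + 1, by omega, h1.symm⟩
        · exact .inl ⟨q', by omega, h2.symm⟩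
      · rcases (h i').nbr q z (by omega) hz with h1 | ⟨q', h1, h2⟩
        · by_cases hqs : q + 1 = r
          · exact .inl ⟨s, by omega, by rw [h1, hqs, hlast]⟩
          · exact .inr ⟨q + 1, by omega, h1.symm⟩
        · exact .inr ⟨q', by omega, h2.symm⟩
    have hcard : Fintype.card V ≤ #((range (s + 1)).image (w i) ∪ (range r).image (w i')) := by
      rw [← card_univ]
      exact card_le_card fun z _ => hall z
    have h1 := card_union_le ((range (s + 1)).image (w i)) ((range r).image (w i'))
    have h2 := card_image_le (s := range (s + 1)) (f := w i)
    have h3 := card_image_le (s := range r) (f := w i')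
    rw [card_range] at h2 h3
    omega

/-- The pendent paths of length `r` form a family of arms. -/
theorem exists_isArmFamily_of_numPendentPaths {V : Type*} [Fintype V] {G : SimpleGraph V}
    (hG : G.Connected) {r : ℕ} (hr : 2 * r < Fintype.card V) :
    ∃ w : {u : Fin (r + 1) → V // IsPendentPath G r u} → ℕ → V, IsArmFamily G r w ∧
      Fintype.card {u : Fin (r + 1) → V // IsPendentPath G r u} = numPendentPaths G r := by
  refine ⟨fun u t => u.1 ⟨min t r, by omega⟩, isArmFamily_of_isArm hG hr (fun u => u.2.isArm) ?_,
    ?_⟩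
  · intro u u' h
    exact Subtype.ext (u.2.eq_of_start u'.2 (by simpa using h))
  · rw [numPendentPaths, ← Nat.card_coe_set_eq, Nat.card_eq_fintype_card]
    rfl

/-- Any set of leaves of a connected graph of order at least three is a family of arms. -/
theorem exists_isArmFamily_of_leaves {V : Type*} [Fintype V] {G : SimpleGraph V}
    (hG : G.Connected) (hn : 3 ≤ Fintype.card V) (L : Finset V) (hL : ∀ v ∈ L, G.degree v = 1) :
    ∃ w : L → ℕ → V, IsArmFamily G 1 w ∧ ∀ v, w v 0 = v := by
  have hex : ∀ v : L, ∃ x, G.Adj v x ∧ ∀ y, G.Adj v y → y = x := fun v =>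
    degree_eq_one_iff_existsUnique_adj.1 (hL v v.2)
  choose f hf hf' using hex
  refine ⟨fun v t => if t = 0 then v else f v, isArmFamily_of_isArm hG (by omega) ?_ ?_, ?_⟩
  · refine fun v => ⟨?_, ?_, ?_⟩
    · intro t ht
      simpa [show t = 0 by omega] using hf v
    · intro t x ht hx
      obtain rfl : t = 0 := by omega
      left
      simpa using hf' v x (by simpa using hx)
    · intro t t' ht ht' heq
      have hne := (hf v).ne
      rcases (show t = 0 ∨ t = 1 by omega) with rfl | rfl <;>
        rcases (show t' = 0 ∨ t' = 1 by omega) with rfl | rfl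
      · rfl
      · exact absurd (by simpa using heq) hne
      · exact absurd (by simpa using heq.symm) hne
      · rfl
  · intro v v' h
    exact Subtype.ext (by simpa using h)
  · intro v
    simp

/-- The pendent paths are counted by their starting leaves. -/
theorem numPendentPaths_eq_card {V ι : Type*} [Fintype V] [Fintype ι] {G : SimpleGraph V} {r : ℕ}
    (f : ι → Fin (r + 1) → V) (hf : ∀ i, IsPendentPath G r (f i))
    (h0 : Function.Injective fun i => f i 0)
    (hall : ∀ u, IsPendentPath G r u → ∃ i, f i 0 = u 0) :
    numPendentPaths G r = Fintype.card ι := by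
  have hinj : Function.Injective f := fun i j hij => h0 (congrFun hij 0)
  have heq : {u | IsPendentPath G r u} = Set.range f := by
    ext u
    constructor
    · intro hu
      obtain ⟨i, hi⟩ := hall u hu
      exact ⟨i, (hf i).eq_of_start hu hi⟩
    · rintro ⟨i, rfl⟩
      exact hf i
  rw [numPendentPaths, heq, Set.ncard_range_of_injective hinj, Nat.card_eq_fintype_card]

end Mostar

/-! ### Invariance under isomorphism -/

namespace Mostar

open Finset SimpleGraph
open scoped Classical

section Iso

variable {V W : Type*} {G : SimpleGraph V} {H : SimpleGraph W}

theorem dist_iso (f : G ≃g H) (hG : G.Connected) (x y : V) : H.dist (f x) (f y) = G.dist x y := by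
  have hH : H.Connected := f.connected_iff.1 hG
  refine le_antisymm ?_ ?_
  · obtain ⟨p, hp⟩ := hG.exists_walk_length_eq_dist x y
    rw [← hp, ← Walk.length_map f.toHom p]
    exact dist_le _
  · obtain ⟨p, hp⟩ := hH.exists_walk_length_eq_dist (f x) (f y)
    have h : G.dist (f.symm (f x)) (f.symm (f y)) ≤ _ := dist_le (p.map f.symm.toHom)
    rwa [Walk.length_map, hp, f.symm_apply_apply, f.symm_apply_apply] at h

theorem numCloser_iso (f : G ≃g H) (hG : G.Connected) (x y : V) :
    numCloser H (f x) (f y) = numCloser G x y := by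
  rw [numCloser, numCloser, ← Set.ncard_image_of_injective _ f.injective]
  congr 1
  ext w
  obtain ⟨w, rfl⟩ := f.surjective w
  simp only [Set.mem_image, Set.mem_ofPred_eq, dist_iso f hG]
  constructor
  · exact fun h => ⟨w, h, rfl⟩
  · rintro ⟨z, hz, hzw⟩
    rwa [← f.injective hzw]

variable [Fintype V] [Fintype W]

theorem mostarIndex_iso (f : G ≃g H) (hG : G.Connected) : mostarIndex G = mostarIndex H := by
  rw [mostarIndex, mostarIndex]
  refine sum_bij (fun e _ => e.map f) ?_ ?_ ?_ ?_
  · intro e he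
    induction e using Sym2.ind with
    | _ x y =>
      rw [mem_edgeFinset, Sym2.map_mk, mem_edgeSet]
      exact f.map_adj_iff.2 (mem_edgeFinset.1 he)
  · intro e _ e' _ h
    exact Sym2.map.injective f.injective h
  · intro e he
    induction e using Sym2.ind with
    | _ x y =>
      refine ⟨s(f.symm x, f.symm y), ?_, by simp⟩
      rw [mem_edgeFinset, mem_edgeSet]
      exact f.symm.map_adj_iff.2 (mem_edgeFinset.1 he)
  · intro e he
    induction e using Sym2.ind with
    | _ x y =>
      simp only [edgeContribution, Sym2.map_mk, Sym2.lift_mk, numCloser_iso f hG]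

theorem IsPendentPath.iso {r : ℕ} {u : Fin (r + 1) → V} (h : IsPendentPath G r u) (f : G ≃g H) :
    IsPendentPath H r (f ∘ u) := by
  obtain ⟨h1, h2, h3, h4, h5, h6⟩ := h
  refine ⟨h1, f.injective.comp h2, fun i => f.map_adj_iff.2 (h3 i), ?_, ?_, ?_⟩
  · rw [Function.comp_apply, f.degree_eq]; exact h4
  · rw [Function.comp_apply, f.degree_eq]; exact h5
  · intro i hi hi'
    rw [Function.comp_apply, f.degree_eq]; exact h6 i hi hi'

theorem numPendentPaths_iso (f : G ≃g H) (r : ℕ) : numPendentPaths G r = numPendentPaths H r := by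
  have hinj : Function.Injective fun u : Fin (r + 1) → V => f ∘ u :=
    fun u u' h => funext fun i => f.injective (congrFun h i)
  rw [numPendentPaths, numPendentPaths, ← Set.ncard_image_of_injective _ hinj]
  congr 1
  ext u
  constructor
  · rintro ⟨u, hu, rfl⟩
    exact IsPendentPath.iso hu f
  · intro hu
    refine ⟨f.symm ∘ u, IsPendentPath.iso hu f.symm, ?_⟩
    funext i
    simp

theorem IsTreeWithPendentPaths.iso {k r : ℕ} (h : IsTreeWithPendentPaths G k r) (f : G ≃g H) :
    IsTreeWithPendentPaths H k r :=
  ⟨f.isTree_iff.1 h.1, (numPendentPaths_iso f r).symm.trans h.2⟩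

/-- `H` is up to isomorphism the only minimizer. -/
theorem isMostarMinimizer_iff {k r : ℕ} (hcard : Fintype.card V = Fintype.card W)
    (hH : IsTreeWithPendentPaths H k r)
    (hmin : ∀ T : SimpleGraph V, IsTreeWithPendentPaths T k r → mostarIndex H ≤ mostarIndex T ∧
      (mostarIndex T = mostarIndex H → Nonempty (T ≃g H))) :
    IsMostarMinimizer G k r ↔ Nonempty (G ≃g H) := by
  constructor
  · rintro ⟨hG, hle⟩
    -- Minimality of `G` ranges over graphs on `V` only, so `H` is transported to `V` to compete
    -- with it.
    let e := Fintype.equivOfCardEq hcard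
    let f : H.comap e ≃g H := Iso.comap e H
    have h1 := hle (H.comap e) (hH.iso f.symm)
    rw [mostarIndex_iso f (f.isTree_iff.2 hH.1).connected] at h1
    exact (hmin G hG).2 (le_antisymm h1 (hmin G hG).1)
  · rintro ⟨f⟩
    have hG := hH.iso f.symm
    refine ⟨hG, fun T hT => ?_⟩
    rw [mostarIndex_iso f hG.1.connected]
    exact (hmin T hT).1

end Iso

/-! ### Pendent paths of the extremal trees and of paths -/

section Counts

variable {n r a b : ℕ}

/-- Each central vertex has a neighbour in either direction along the path; at the two ends an arm
supplies it, which needs `a, b ≥ 1`. -/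
theorem two_le_degree_aTree_inl (hm : (a + b) * r + 2 ≤ n) (hr : 1 ≤ r) (ha : 1 ≤ a) (hb : 1 ≤ b)
    (i : Fin (n - (a + b) * r)) : 2 ≤ (aTree n r a b).degree (.inl i) := by
  have hi := i.isLt
  have hleft : ∃ x, (aTree n r a b).Adj (.inl i) x ∧
      (x = .inr (.inl ⟨0, ha⟩, ⟨0, hr⟩) ∨ ∃ j, x = .inl j ∧ j.val + 1 = i.val) := by
    by_cases h : i.val = 0
    · exact ⟨_, (aTree_adj_inl_inr hm _ _ _).2 ⟨Fin.ext (by simp [aRoot, h]), rfl⟩, .inl rfl⟩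
    · refine ⟨.inl ⟨i.val - 1, by omega⟩, (aTree_adj_inl_inl _ _).2 ?_, .inr ⟨_, rfl, ?_⟩⟩ <;>
        simp only <;> omega
  have hright : ∃ x, (aTree n r a b).Adj (.inl i) x ∧
      (x = .inr (.inr ⟨0, hb⟩, ⟨0, hr⟩) ∨ ∃ j, x = .inl j ∧ i.val + 1 = j.val) := by
    by_cases h : i.val = n - (a + b) * r - 1
    · exact ⟨_, (aTree_adj_inl_inr hm _ _ _).2 ⟨Fin.ext (by simp [aRoot, h]), rfl⟩, .inl rfl⟩
    · exact ⟨.inl ⟨i.val + 1, by omega⟩, (aTree_adj_inl_inl _ _).2 (.inl rfl), .inr ⟨_, rfl, rfl⟩⟩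
  obtain ⟨x, hx, hx'⟩ := hleft
  obtain ⟨y, hy, hy'⟩ := hright
  refine two_le_degree hx hy ?_
  rintro rfl
  rcases hx' with rfl | ⟨j, rfl, hj⟩ <;> rcases hy' with h | ⟨j', h, hj'⟩
  · simp at h
  · simp at h
  · simp at h
  · simp only [Sum.inl.injEq] at h
    subst h
    omega

theorem eq_of_degree_aTree_eq_one (hm : (a + b) * r + 2 ≤ n) (hr : 1 ≤ r) (ha : 1 ≤ a)
    (hb : 1 ≤ b) {x : AVertex n r a b} (hx : (aTree n r a b).degree x = 1) :
    ∃ p, aArm hm p 0 = x := by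
  rcases x with i | ⟨p, j⟩
  · have := two_le_degree_aTree_inl hm hr ha hb i
    omega
  · refine ⟨p, ?_⟩
    have hj := j.isLt
    by_contra hne
    have hjr : j.val + 1 < r := by
      by_contra hc
      refine hne ?_
      simp only [aArm, show 0 < r by omega, dite_true, Sum.inr.injEq, Prod.mk.injEq, true_and,
        Fin.ext_iff]
      omega
    have hup : (aTree n r a b).Adj (.inr (p, j)) (.inr (p, ⟨j.val + 1, hjr⟩)) :=
      (aTree_adj_inr_inr _ _ _ _).2 ⟨rfl, .inl rfl⟩
    have : 2 ≤ (aTree n r a b).degree (.inr (p, j)) := by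
      by_cases h0 : j.val = 0
      · exact two_le_degree hup ((aTree_adj_inl_inr hm _ _ _).2 ⟨rfl, h0⟩).symm (by simp)
      · refine two_le_degree hup (y := .inr (p, ⟨j.val - 1, by omega⟩))
          ((aTree_adj_inr_inr _ _ _ _).2 ⟨rfl, .inr (by simp only; omega)⟩) ?_
        simp only [ne_eq, Sum.inr.injEq, Prod.mk.injEq, true_and, Fin.ext_iff]
        omega
    omega

theorem numPendentPaths_aTree (hm : (a + b) * r + 2 ≤ n) (hr : 1 ≤ r) (ha : 1 ≤ a) (hb : 1 ≤ b) :
    numPendentPaths (aTree n r a b) r = a + b := by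
  have hfam := isArmFamily_aArm (n := n) (r := r) (a := a) (b := b) hm
  rw [numPendentPaths_eq_card (fun p t => aArm hm p t.val)]
  · simp
  · intro p
    refine (hfam.isArm p).isPendentPath hr ?_
    have : aArm hm p r = .inl (aRoot hm p) := by simp [aArm]
    rw [this]
    exact two_le_degree_aTree_inl hm hr ha hb _
  · intro p q hpq
    exact (hfam.inj _ _ _ _ (by omega) hr hpq).1
  · intro u hu
    exact eq_of_degree_aTree_eq_one hm hr ha hb hu.2.2.2.1

/-- The long arm of `aTree n 1 1 2`. -/
theorem isArm_aTree_one_two {s : ℕ} (hs : s + 3 ≤ n) (hn : 5 ≤ n) :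
    IsArm (aTree n 1 1 2) s fun t => if t = 0 then .inr (.inl 0, 0) else
      .inl ⟨min (t - 1) (n - 4), by omega⟩ := by
  have hm : (1 + 2) * 1 + 2 ≤ n := by omega
  refine ⟨?_, ?_, ?_⟩
  · intro t ht
    rcases t with _ | t
    · simp only [if_true, Nat.add_eq_zero_iff, one_ne_zero, and_false, if_false]
      rw [SimpleGraph.adj_comm, aTree_adj_inl_inr hm]
      exact ⟨Fin.ext (by simp [aRoot]), rfl⟩
    · simp only [Nat.add_eq_zero_iff, one_ne_zero, and_false, if_false]
      rw [aTree_adj_inl_inl]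
      simp only
      omega
  · intro t x ht hx
    rcases t with _ | t
    · left
      simp only [if_true] at hx
      rcases x with i | ⟨p, j⟩
      · rw [SimpleGraph.adj_comm, aTree_adj_inl_inr hm] at hx
        rw [hx.1]
        simp [aRoot]
      · rw [aTree_adj_inr_inr] at hx
        omega
    · simp only [Nat.add_eq_zero_iff, one_ne_zero, and_false, if_false] at hx
      rcases x with i | ⟨p, j⟩
      · rw [aTree_adj_inl_inl] at hx
        simp only at hx
        have hi := i.isLt
        rcases hx with hx | hx
        · left
          simp only [Nat.add_eq_zero_iff, one_ne_zero, and_false, if_false, Sum.inl.injEq,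
            Fin.ext_iff]
          omega
        · right
          refine ⟨t, rfl, ?_⟩
          rw [if_neg (by omega)]
          simp only [Sum.inl.injEq, Fin.ext_iff]
          omega
      · rw [aTree_adj_inl_inr hm] at hx
        rcases p with p | p
        · right
          simp only [aRoot, Fin.mk.injEq] at hx
          refine ⟨0, by omega, ?_⟩
          simp only [if_true, Sum.inr.injEq, Prod.mk.injEq, Sum.inl.injEq]
          exact ⟨Subsingleton.elim _ _, Subsingleton.elim _ _⟩
        · simp only [aRoot, Fin.mk.injEq] at hx
          omega
  · intro t t' ht ht' heq
    by_cases h : t = 0 <;> by_cases h' : t' = 0 <;>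
      simp only [h, h', if_true, if_false, reduceCtorEq, Sum.inl.injEq, Fin.mk.injEq] at heq ⊢
    omega

/-- Only the leaf at the end with a single attached leaf starts a pendent path of length `s ≥ 2`:
the other two leaves share a neighbour of degree three, which would have to be an inner vertex. -/
theorem numPendentPaths_aTree_one_two {s : ℕ} (hs : s + 3 ≤ n) (hs2 : 2 ≤ s) :
    numPendentPaths (aTree n 1 1 2) s = 1 := by
  have hm : (1 + 2) * 1 + 2 ≤ n := by omega
  have harm := isArm_aTree_one_two hs (by omega)
  rw [numPendentPaths_eq_card (ι := Unit) (fun _ => _)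
    (fun _ => harm.isPendentPath (by omega) ?_)]
  · simp
  · exact fun _ _ _ => rfl
  · intro u hu
    refine ⟨(), ?_⟩
    obtain ⟨p, hp⟩ := eq_of_degree_aTree_eq_one hm le_rfl le_rfl (by omega) hu.2.2.2.1
    rcases p with p | p
    · rw [← hp]
      simp only [aArm, Fin.val_zero, if_true, zero_lt_one, dite_true, Sum.inr.injEq,
        Prod.mk.injEq, Sum.inl.injEq]
      exact ⟨Subsingleton.elim _ _, Subsingleton.elim _ _⟩
    · exfalso
      have h1 := hu.2.2.1 ⟨0, by omega⟩
      have h2 : u (Fin.castSucc ⟨0, by omega⟩) = u 0 := rfl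
      set z := u (Fin.succ ⟨0, by omega⟩) with hz
      rw [h2, ← hp] at h1
      have h3 : z = .inl (aRoot hm (.inr p)) := by
        rcases (isArmFamily_aArm hm).nbr _ _ _ (by omega) h1 with h3 | ⟨_, h3, -⟩
        · simpa [aArm] using h3
        · omega
      have h4 := hu.2.2.2.2.2 (Fin.succ ⟨0, by omega⟩) (by simp [Fin.ext_iff])
        (by simp [Fin.ext_iff]; omega)
      rw [← hz, h3] at h4
      have h5 : ∀ q : Fin 2, (aTree n 1 1 2).Adj (.inl (aRoot hm (.inr p))) (.inr (.inr q, 0)) :=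
        fun q => (aTree_adj_inl_inr hm _ _ _).2 ⟨rfl, rfl⟩
      have h6 : (aTree n 1 1 2).Adj (.inl (aRoot hm (.inr p))) (.inl ⟨n - 5, by omega⟩) := by
        rw [aTree_adj_inl_inl]
        simp only [aRoot]
        omega
      rcases eq_or_eq_of_degree_eq_two (h5 0) (h5 1) (by simp) h4 h6 with h7 | h7 <;>
        simp at h7
  · rw [if_neg (by omega)]
    exact two_le_degree_aTree_inl hm le_rfl le_rfl (by omega) _

/-- One pendent path starts at each end; `r + 2 ≤ n` ensures that it stops at an inner vertex, of
degree two. -/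
theorem numPendentPaths_pathGraph (hr : 1 ≤ r) (hn : r + 2 ≤ n) :
    numPendentPaths (pathGraph n) r = 2 := by
  have h1 : IsArm (pathGraph n) r fun t => ⟨min t (n - 1), by omega⟩ := by
    refine ⟨?_, ?_, ?_⟩
    · intro t ht
      rw [pathGraph_adj]
      simp only
      omega
    · intro t x ht hx
      rw [pathGraph_adj] at hx
      have hx' := x.isLt
      simp only [Fin.ext_iff] at hx ⊢
      rcases hx with hx | hx
      · left; omega
      · exact .inr ⟨x.val, by omega, by omega⟩
    · intro t t' ht ht' h
      simp only [Fin.ext_iff] at h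
      omega
  have h2 : IsArm (pathGraph n) r fun t => ⟨n - 1 - t, by omega⟩ := by
    refine ⟨?_, ?_, ?_⟩
    · intro t ht
      rw [pathGraph_adj]
      simp only
      omega
    · intro t x ht hx
      rw [pathGraph_adj] at hx
      have hx' := x.isLt
      simp only [Fin.ext_iff] at hx ⊢
      rcases hx with hx | hx
      · exact .inr ⟨n - 1 - x.val, by omega, by omega⟩
      · left; omega
    · intro t t' ht ht' h
      simp only [Fin.ext_iff] at h
      omega
  have hdeg : ∀ i : Fin n, 0 < i.val → i.val + 1 < n → 2 ≤ (pathGraph n).degree i := by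
    intro i h0 hi
    refine two_le_degree (x := ⟨i.val - 1, by omega⟩) (y := ⟨i.val + 1, hi⟩) ?_ ?_ ?_
    · rw [pathGraph_adj]; simp only; omega
    · rw [pathGraph_adj]; exact .inl rfl
    · simp only [ne_eq, Fin.ext_iff]; omega
  rw [numPendentPaths_eq_card (ι := Bool) (fun c t => if c then ⟨min t.val (n - 1), by omega⟩ else
    ⟨n - 1 - t.val, by omega⟩)]
  · simp
  · rintro (_ | _)
    · simp only [Bool.false_eq_true, if_false]
      exact h2.isPendentPath hr (hdeg _ (by simp only; omega) (by simp only; omega))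
    · simp only [if_true]
      exact h1.isPendentPath hr (hdeg _ (by simp only; omega) (by simp only; omega))
  · rintro (_ | _) (_ | _) h
    · rfl
    · simp [Fin.ext_iff] at h; omega
    · simp [Fin.ext_iff] at h; omega
    · rfl
  · intro u hu
    have hd := hu.2.2.2.1
    have hu0 := (u 0).isLt
    by_cases h0 : (u 0).val = 0
    · exact ⟨true, Fin.ext (by simp [h0])⟩
    · by_cases hl : (u 0).val + 1 < n
      · have := hdeg (u 0) (by omega) hl
        omega
      · exact ⟨false, Fin.ext (by simp; omega)⟩

/-- The central path of `aTree` needs two vertices besides the two attached leaves, hence `n ≥ 4`;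
order three is treated separately. -/
theorem nonempty_aTree_iso_pathGraph (hn : 4 ≤ n) :
    Nonempty (aTree n 1 1 1 ≃g pathGraph n) := by
  have hm : (1 + 1) * 1 + 2 ≤ n := by omega
  let f : Fin n → AVertex n 1 1 1 := fun i =>
    if h0 : i.val = 0 then .inr (.inl 0, 0) else
      if h1 : i.val = n - 1 then .inr (.inr 0, 0) else .inl ⟨i.val - 1, by omega⟩
  have hinj : Function.Injective f := by
    intro i j hij
    have hi := i.isLt
    have hj := j.isLt
    apply Fin.ext
    simp only [f] at hij
    split_ifs at hij <;> simp at hij <;> omega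
  have hstep : ∀ i j : Fin n, i.val + 1 = j.val → (aTree n 1 1 1).Adj (f i) (f j) := by
    intro i j hij
    have hi := i.isLt
    have hj := j.isLt
    simp only [f]
    split_ifs with h1 h2 h3 h4 h5 h6 <;> try omega
    · rw [SimpleGraph.adj_comm, aTree_adj_inl_inr hm]
      exact ⟨Fin.ext (by simp [aRoot]; omega), rfl⟩
    · rw [aTree_adj_inl_inr hm]
      exact ⟨Fin.ext (by simp [aRoot]; omega), rfl⟩
    · rw [aTree_adj_inl_inl]
      simp only
      omega
  have hconn : (pathGraph n).Connected := by
    obtain ⟨k, rfl⟩ : ∃ k, n = k + 1 := ⟨n - 1, by omega⟩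
    exact pathGraph_connected k
  refine nonempty_iso_of_bijective hconn (aTree_isTree hm) f ?_ ?_
  · rw [Fintype.bijective_iff_injective_and_card]
    exact ⟨hinj, by rw [card_aVertex hm, Fintype.card_fin]⟩
  · intro i j hij
    rw [pathGraph_adj] at hij
    rcases hij with h | h
    · exact hstep i j h
    · exact (hstep j i h).symm

end Counts

end Mostar

/-! ### The three cases of the theorem -/

namespace Mostar

open Finset SimpleGraph
open scoped Classical

variable {V : Type*} [Fintype V] {T : SimpleGraph V} {n : ℕ}

theorem two_le_card_leaves (hT : T.IsTree) (hn : 2 ≤ Fintype.card V) :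
    2 ≤ #{v | T.degree v = 1} := by
  have : Nontrivial V := Fintype.one_lt_card_iff_nontrivial.1 hn
  obtain ⟨u, v, huv, hu, hv⟩ := hT.exists_ne_and_degree_eq_one
  rw [← card_pair huv]
  exact card_le_card (by simp [insert_subset_iff, hu, hv])

/-- Among all trees of order `n` with at least `a + b` leaves, where `a` and `b` differ by at most
one, `aTree n 1 a b` is the only one with the least Mostar index. -/
theorem mostarIndex_aTree_one_le (hT : T.IsTree) {a b : ℕ} (hn : Fintype.card V = n)
    (hm : a + b + 2 ≤ n) (ha : 1 ≤ a) (hb : 1 ≤ b) (hab : a ≤ b + 1) (hba : b ≤ a + 1)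
    (hL : a + b ≤ #{v | T.degree v = 1}) :
    mostarIndex (aTree n 1 a b) ≤ mostarIndex T ∧
      (mostarIndex T = mostarIndex (aTree n 1 a b) → Nonempty (T ≃g aTree n 1 a b)) := by
  -- Surplus leaves are simply left to the core, so a lower bound on the number of leaves suffices.
  obtain ⟨L, hLsub, hLcard⟩ := exists_subset_card_eq hL
  obtain ⟨w, hw, -⟩ := exists_isArmFamily_of_leaves hT.connected (by omega) L
    fun v hv => (mem_filter.1 (hLsub hv)).2
  exact hw.mostarIndex_aTree_le hT hn (by omega) (by simpa using hLcard) le_rfl ha hb hab hba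

/-- A tree with exactly two leaves is a path. -/
theorem nonempty_iso_pathGraph_of_two_leaves (hT : T.IsTree) (hn : Fintype.card V = n)
    (hn4 : 4 ≤ n) (hL : #{v | T.degree v = 1} = 2) : Nonempty (T ≃g pathGraph n) := by
  obtain ⟨w, hw, hw0⟩ := exists_isArmFamily_of_leaves hT.connected (by omega)
    ({v | T.degree v = 1} : Finset V) fun v hv => (mem_filter.1 hv).2
  -- A side with one vertex is a leaf, and all edges at leaves are arm edges. With `a = b = 1` this
  -- is already the hypothesis of the equality case.
  have hside : ∀ u v, s(u, v) ∈ coreEdges T 1 w → 1 < #(side T u v) := by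
    intro u v huv
    have hcut := isCut_side hT (mem_coreEdges.1 huv).1
    simp only at hcut
    by_contra hc
    have huniq : ∀ z ∈ side T u v, z = u := fun z hz => card_le_one.1 (not_lt.1 hc) z hz u hcut.mem
    have hdeg : T.degree u = 1 := by
      rw [degree_eq_one_iff_existsUnique_adj]
      refine ⟨v, hcut.adj, fun z hz => (hcut.unique u hcut.mem z (fun h => ?_) hz).2⟩
      exact hz.ne (huniq z h).symm
    have hu : u ∈ ({v | T.degree v = 1} : Finset V) := by simpa using hdeg
    exact hw.notMem_of_mem_coreEdges huv ⟨u, hu⟩ zero_lt_one (hw0 ⟨u, hu⟩).symm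
  obtain ⟨f⟩ := hw.nonempty_iso_of_lt_smallSide hT (a := 1) (b := 1) hn (by omega)
    ((Fintype.card_coe _).trans hL) le_rfl le_rfl le_rfl (by omega) (by omega) (fun e he => by
      induction e using Sym2.ind with
      | _ u v =>
        rw [smallSide_mk, min_self, one_mul, lt_min_iff]
        exact ⟨hside u v he, hside v u (by rwa [Sym2.eq_swap])⟩) (fun h => absurd rfl h)
  obtain ⟨g⟩ := nonempty_aTree_iso_pathGraph hn4
  exact ⟨f.trans g⟩

/-- Every tree of order three is a path. -/
theorem nonempty_iso_pathGraph_three (hT : T.IsTree) (hn : Fintype.card V = 3) :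
    Nonempty (T ≃g pathGraph 3) := by
  have : Nontrivial V := Fintype.one_lt_card_iff_nontrivial.1 (by omega)
  obtain ⟨x, y, hxy, hx, hy⟩ := hT.exists_ne_and_degree_eq_one
  obtain ⟨c, hc⟩ : ∃ c, c ∉ ({x, y} : Finset V) := by
    by_contra! hc
    have h1 := card_le_card (s := univ) (t := ({x, y} : Finset V)) fun z _ => hc z
    rw [card_univ, card_pair hxy] at h1
    omega
  simp only [mem_insert, mem_singleton, not_or] at hc
  have hall : ∀ z, z = x ∨ z = y ∨ z = c := by
    intro z
    have h3 : #{x, y, c} = 3 := card_eq_three.2 ⟨x, y, c, hxy, Ne.symm hc.1, Ne.symm hc.2, rfl⟩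
    have h4 : ({x, y, c} : Finset V) = univ := by rw [← card_eq_iff_eq_univ, h3, hn]
    have h5 : z ∈ ({x, y, c} : Finset V) := h4 ▸ mem_univ z
    simpa using h5
  rw [degree_eq_one_iff_existsUnique_adj] at hx hy
  obtain ⟨x', hx', hx''⟩ := hx
  obtain ⟨y', hy', hy''⟩ := hy
  have hnot : ¬ T.Adj x y := by
    intro hadj
    have := mem_of_adj_closed hT.connected {x, y} (x := x) (by simp) (by
      rintro z (rfl | rfl) t ht
      · right; rw [hx'' t ht, hx'' _ hadj]; rfl
      · left; rw [hy'' t ht, hy'' _ hadj.symm]) c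
    rcases this with h | h
    · exact hc.1 h
    · exact hc.2 h
  have hxc : T.Adj x c := by
    rcases hall x' with rfl | rfl | rfl
    · exact absurd rfl hx'.ne
    · exact absurd hx' hnot
    · exact hx'
  have hyc : T.Adj y c := by
    rcases hall y' with rfl | rfl | rfl
    · exact absurd hy'.symm hnot
    · exact absurd rfl hy'.ne
    · exact hy'
  refine nonempty_iso_of_bijective (pathGraph_connected 2) hT ![x, c, y] ?_ ?_
  · rw [Fintype.bijective_iff_injective_and_card]
    refine ⟨?_, by rw [hn, Fintype.card_fin]⟩
    intro i j hij
    fin_cases i <;> fin_cases j <;> simp_all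
  · intro i j hij
    rw [pathGraph_adj] at hij
    have hcx := hxc.symm
    have hcy := hyc.symm
    fin_cases i <;> fin_cases j <;> simp at hij ⊢ <;> assumption

theorem mostarIndex_pathGraph_le (hT : T.IsTree) (hn : Fintype.card V = n) (hn3 : 3 ≤ n) :
    mostarIndex (pathGraph n) ≤ mostarIndex T ∧
      (mostarIndex T = mostarIndex (pathGraph n) → Nonempty (T ≃g pathGraph n)) := by
  rcases hn3.eq_or_lt with rfl | hn4
  · obtain ⟨f⟩ := nonempty_iso_pathGraph_three hT hn
    exact ⟨(mostarIndex_iso f hT.connected).ge, fun _ => ⟨f⟩⟩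
  · have hm : (1 + 1) * 1 + 2 ≤ n := by omega
    obtain ⟨g⟩ := nonempty_aTree_iso_pathGraph hn4
    obtain ⟨h1, h2⟩ := mostarIndex_aTree_one_le hT (a := 1) (b := 1) hn hn4 le_rfl le_rfl
      (by omega) (by omega) (two_le_card_leaves hT (by omega))
    rw [← mostarIndex_iso g (aTree_connected hm)]
    exact ⟨h1, fun h => (h2 h).map fun f => f.trans g⟩

theorem pathGraph_isTree (hn : 3 ≤ n) : (pathGraph n).IsTree := by
  have hconn : (pathGraph n).Connected := by
    obtain ⟨k, rfl⟩ : ∃ k, n = k + 1 := ⟨n - 1, by omega⟩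
    exact pathGraph_connected k
  refine isTree_of_isCut hconn fun e he => ?_
  have key : ∀ i j : Fin n, i.val + 1 = j.val → IsCut (pathGraph n) (Iic i) i j := by
    intro i j hij
    refine ⟨pathGraph_adj.2 (.inl hij), by simp, by simp only [mem_Iic, Fin.le_def]; omega, ?_⟩
    intro x hx y hy hxy
    rw [pathGraph_adj] at hxy
    simp only [mem_Iic, Fin.le_def, Fin.ext_iff] at *
    omega
  induction e using Sym2.ind with
  | _ i j =>
    rcases pathGraph_adj.1 he with h | h
    · exact ⟨_, _, _, rfl, key i j h⟩
    · exact ⟨_, _, _, Sym2.eq_swap, key j i h⟩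

theorem isMostarMinimizer_one_iff {r : ℕ} (hn : Fintype.card V = n) (hr : 2 ≤ r)
    (hrn : r + 3 ≤ n) : IsMostarMinimizer T 1 r ↔ Nonempty (T ≃g aTree n 1 1 2) := by
  have hm : (1 + 2) * 1 + 2 ≤ n := by omega
  refine isMostarMinimizer_iff (hn.trans (card_aVertex hm).symm)
    ⟨aTree_isTree hm, numPendentPaths_aTree_one_two hrn hr⟩ fun T' hT' => ?_
  refine mostarIndex_aTree_one_le hT'.1 hn (by omega) le_rfl (by omega) (by omega) (by omega) ?_
  have h2 := two_le_card_leaves hT'.1 (by omega)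
  -- With fewer than three leaves the tree would be a path, which has two pendent paths of length
  -- `r` rather than one.
  by_contra hc
  obtain ⟨f⟩ := nonempty_iso_pathGraph_of_two_leaves hT'.1 hn (by omega) (by omega)
  have h3 := numPendentPaths_iso f r
  rw [hT'.2, numPendentPaths_pathGraph (by omega) (by omega)] at h3
  omega

theorem isMostarMinimizer_two_iff {r : ℕ} (hn : Fintype.card V = n) (hr : 1 ≤ r)
    (hrn : r + 2 ≤ n) : IsMostarMinimizer T 2 r ↔ Nonempty (T ≃g pathGraph n) :=
  isMostarMinimizer_iff (by rw [hn, Fintype.card_fin])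
    ⟨pathGraph_isTree (by omega), numPendentPaths_pathGraph hr hrn⟩
    fun T' hT' => mostarIndex_pathGraph_le hT'.1 hn (by omega)

theorem isMostarMinimizer_iff_of_three_le {k r : ℕ} (hn : Fintype.card V = n) (hk : 3 ≤ k)
    (hr : 1 ≤ r) (hkn : k * r + 2 ≤ n) :
    IsMostarMinimizer T k r ↔ Nonempty (T ≃g aTree n r ((k + 1) / 2) (k / 2)) := by
  have hsum : (k + 1) / 2 + k / 2 = k := by omega
  have hm : ((k + 1) / 2 + k / 2) * r + 2 ≤ n := by rw [hsum]; exact hkn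
  have ha : 1 ≤ (k + 1) / 2 := by omega
  have hb : 1 ≤ k / 2 := by omega
  refine isMostarMinimizer_iff (hn.trans (card_aVertex hm).symm)
    ⟨aTree_isTree hm, (numPendentPaths_aTree hm hr ha hb).trans hsum⟩ fun T' hT' => ?_
  -- From `k ≥ 3` follows `2 r < n`, which makes distinct pendent paths disjoint up to their ends.
  have h3 := Nat.mul_le_mul_right r hk
  obtain ⟨w, hw, hcard⟩ := exists_isArmFamily_of_numPendentPaths hT'.1.connected (r := r)
    (by omega)
  exact hw.mostarIndex_aTree_le hT'.1 hn hm (hcard.trans (hT'.2.trans hsum.symm)) hr ha hb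
    (by omega) (by omega)

end Mostar

theorem mainTheorem5 {V : Type*} [Fintype V] (T : SimpleGraph V) (n k r : ℕ)
    (hn : Fintype.card V = n) :
    (k = 1 → 2 ≤ r → r + 3 ≤ n →
      (Mostar.IsMostarMinimizer T k r ↔ Nonempty (T ≃g Mostar.aTree n 1 1 2))) ∧
    (k = 2 → 1 ≤ r → r + 2 ≤ n →
      (Mostar.IsMostarMinimizer T k r ↔ Nonempty (T ≃g SimpleGraph.pathGraph n))) ∧
    (3 ≤ k → 1 ≤ r → k * r + 2 ≤ n →
      (Mostar.IsMostarMinimizer T k r ↔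
        Nonempty (T ≃g Mostar.aTree n r ((k + 1) / 2) (k / 2)))) := by
  refine ⟨?_, ?_, ?_⟩
  · rintro rfl hr hrn
    exact Mostar.isMostarMinimizer_one_iff hn hr hrn
  · rintro rfl hr hrn
    exact Mostar.isMostarMinimizer_two_iff hn hr hrn
  · exact Mostar.isMostarMinimizer_iff_of_three_le hn
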